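/- **Setting.** Let $M\ge 0$ be an integer and let $c,\sigma_{\min}>0$, $q\ge 2$, $C\ge 1$ be reals. The class $\mathcal D(M,q,c,\sigma_{\min},C)$ consists of all sequences $(X_j)_{j\in\mathbb N}$, $\mathbb N=\{1,2,\dots\}$, of absolutely continuous real random variables on a probability space, with means $\mu_j=E[X_j]$, such that: the sequence is $M$-dependent, i.e. $(X_j)_{j\le k}$ and $(X_j)_{j\ge k+M+1}$ are independent for every $k\in\mathbb N$; and for every $j$, $E|X_j|^q\le C$, $E|X_j-\mu_j|^q\le C$, $\mathrm{sd}(X_j)\ge\sigma_{\min}$, and the probability density of $X_j$ is bounded by $c$. A geometric median of $(X_1,\dots,X_p)$ is a vector $\mathbf m\in\mathbb R^p$ minimizing $E\|(X_1,\dots,X_p)-\mathbf m\|$, where $\|\cdot\|$ is the Euclidean norm. **Theorem.** Let $M\ge 0$ and $q>3$. (1) Let $(X_j)_j\in\mathcal D(M,q,c,\sigma_{\min},C)$. For every $p\ge M+2$ the vector $(X_1,\dots,X_p)$ has a unique geometric median $\mathbf m_p=(m_{p,1},\dots,m_{p,p})$. Fix $i\in\mathbb N$. If $\frac1p\sum_{j=1}^p\mathrm{Var}(X_j)\to\bar\sigma^2\in\mathbb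 R$ as $p\to\infty$, then, as $p\to\infty$, $$m_{p,i}=\mu_i-\frac{1}{2\bar\sigma^2 p}\sum_{j\in\mathcal E(i)}E\big[(X_i-\mu_i)(X_j-\mu_j)^2\big]+o\Big(\frac1p\Big),\qquad \mathcal E(i)=\{i-M,\dots,i+M\}\cap\mathbb N.$$ (2) The rate $1/p$ is sharp in general: there are $c,\sigma_{\min}>0$, $C\ge1$, a sequence $(X_j)_j\in\mathcal D(M,q,c,\sigma_{\min},C)$ and a constant $b>0$ such that for every $i\in\mathbb N$ one has $|m_{p,i}-\mu_i|\ge b/p$ for all sufficiently large $p$. -/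

import Mathlib

open MeasureTheory ProbabilityTheory Filter Topology Asymptotics

/-- `M`-dependence of a sequence of real random variables (indexed from `0`): for every `k`, the
families `(X j)_{j ≤ k}` and `(X j)_{j ≥ k + M + 1}` are independent. -/
def IsMDependent {Ω : Type*} [MeasurableSpace Ω] (P : Measure Ω) (M : ℕ) (X : ℕ → Ω → ℝ) : Prop :=
  ∀ k : ℕ, IndepFun (fun ω (j : Set.Iic k) => X j ω) (fun ω (j : Set.Ici (k + M + 1)) => X j ω) P

/-- The class `𝒟(M, q, c, σ_min, C)` of sequences of absolutely continuous random variables. -/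
structure ClassD {Ω : Type*} [MeasurableSpace Ω] (P : Measure Ω) (M : ℕ) (q c σmin C : ℝ)
    (X : ℕ → Ω → ℝ) : Prop where
  c_pos : 0 < c
  σmin_pos : 0 < σmin
  two_le_q : 2 ≤ q
  one_le_C : 1 ≤ C
  measurable : ∀ j, Measurable (X j)
  /-- each law is absolutely continuous with respect to Lebesgue measure -/
  hasPDF : ∀ j, HasPDF (X j) P volume
  /-- the densities (defined up to null sets) are bounded by `c` -/
  pdf_le : ∀ j, ∀ᵐ x : ℝ, pdf (X j) P volume x ≤ ENNReal.ofReal c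
  mDependent : IsMDependent P M X
  integrable_abs_pow : ∀ j, Integrable (fun ω => |X j ω| ^ q) P
  abs_pow_le : ∀ j, ∫ ω, |X j ω| ^ q ∂P ≤ C
  integrable_abs_sub_pow : ∀ j, Integrable (fun ω => |X j ω - ∫ ω', X j ω' ∂P| ^ q) P
  abs_sub_pow_le : ∀ j, ∫ ω, |X j ω - ∫ ω', X j ω' ∂P| ^ q ∂P ≤ C
  le_sd : ∀ j, σmin ≤ √(variance (X j) P)

/-- The random vector in Euclidean `ℝᵖ` formed by the first `p` components of the sequence. -/
def firstComponents {Ω : Type*} (X : ℕ → Ω → ℝ) (p : ℕ) (ω : Ω) : EuclideanSpace ℝ (Fin p) :=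
  WithLp.toLp 2 (fun j : Fin p => X j ω)

/-- `v` is a geometric median of the (integrable) random vector `Y`: it minimizes
`v ↦ E ‖Y - v‖` for the Euclidean norm. -/
def IsGeometricMedian {Ω : Type*} [MeasurableSpace Ω] (P : Measure Ω) {p : ℕ}
    (Y : Ω → EuclideanSpace ℝ (Fin p)) (v : EuclideanSpace ℝ (Fin p)) : Prop :=
  ∀ w : EuclideanSpace ℝ (Fin p), ∫ ω, ‖Y ω - v‖ ∂P ≤ ∫ ω, ‖Y ω - w‖ ∂P

/-- The set `{i - M, …, i + M} ∩ ℕ`. Truncated subtraction realizes the intersection with `ℕ`. -/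
def exclusionSet (M i : ℕ) : Finset ℕ := Finset.Icc (i - M) (i + M)

/-!
Write `μ j = E[X j]`, `Y j = X j - μ j`, let `v` be a geometric median of `(X 0, …, X (p - 1))` and
`N = ∑_{j < p} (X j - v j)²`. The median exists because `v ↦ E ‖X - v‖` is continuous and coercive.
It is unique because two minimizers would force `X` to lie almost surely on the line through them
(`IsGeometricMedian.ae_collinear`), while `X 0` and `X (M + 1)` are independent and nondegenerate.

Differentiating `E ‖X - v‖` gives `E[(X i - v i) / √N] = 0`, that is
`(v i - μ i) E[1 / √N] = E[Y i / √N]`. The factor `E[1 / √N]` is asymptotic to `1 / (σbar √p)`. For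
the right-hand side let `R` be the part of `N` over the indices at distance more than `M` from `i`.
Then `R` is independent of `X i` (`IsMDependent.indepFun_sqDist`), so `E[Y i / √R] = 0`, and only
`1 / √N - 1 / √R ≈ -(N - R) / (2 R^{3/2})` contributes. Since `R` and `N` are both about `σbar² p`,
this leaves `-(1 / (2 σbar³ p^{3/2})) ∑_j E[Y i (Y j)²]` over the exclusion set of `i`. The exact form
of this expansion is `ClassD.exists_mul_sub_mul_integral_eq`.

Three ingredients justify the limit.
* All negative moments of `R / p` are bounded, uniformly in the centre `v`
  (`ClassD.exists_negMoment_bound`): bounded densities give `E |X j - v j|^{-1/2} ≤ K`, independence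
  turns this into a bound for blocks of spaced indices, and convexity averages over the blocks.
* The deviations `v i - μ i` are `O(1 / p)` uniformly in `i` (`ClassD.exists_abs_sub_mean_le_div`):
  the Cauchy–Schwarz inequality first gives `O(1)`, and the exact expansion improves this.
* `N / p` and `R / p` converge to `σbar²` in `L¹`, by truncation and a variance bound
  (`ClassD.tendsto_integral_abs_sum_sq_sub`). As `q > 3`, the products `Y i (Y j)²` are bounded in
  some `L^s` with `s > 1`, so that convergence in probability and bounded negative moments suffice
  (`tendsto_integral_mul_zero`).

The rate is attained by an independent sequence with density `2x` on `[0, 1]`, whose third central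
moment is nonzero.
-/

/-! ### Independence in an `M`-dependent sequence -/

section Independence

variable {Ω : Type*} [MeasurableSpace Ω] {P : Measure Ω} {M : ℕ} {X : ℕ → Ω → ℝ}

/-- Squared Euclidean distance from `(X j)_{j ∈ s}` to `(v j)_{j ∈ s}`. -/
def sqDist (X : ℕ → Ω → ℝ) (v : ℕ → ℝ) (s : Finset ℕ) (ω : Ω) : ℝ :=
  ∑ j ∈ s, (X j ω - v j) ^ 2

omit [MeasurableSpace Ω] in
lemma sqDist_nonneg (v : ℕ → ℝ) (s : Finset ℕ) (ω : Ω) : 0 ≤ sqDist X v s ω :=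
  Finset.sum_nonneg fun _ _ => sq_nonneg _

lemma measurable_sqDist (hX : ∀ j, Measurable (X j)) (v : ℕ → ℝ) (s : Finset ℕ) :
    Measurable (sqDist X v s) := by
  unfold sqDist
  fun_prop

lemma IsMDependent.indepFun (h : IsMDependent P M X) {i j : ℕ} (hij : i + M < j) :
    IndepFun (X i) (X j) P :=
  (h i).comp (φ := fun f : Set.Iic i → ℝ => f ⟨i, Set.mem_Iic.2 le_rfl⟩)
    (ψ := fun f : Set.Ici (i + M + 1) → ℝ => f ⟨j, hij⟩)
    (measurable_pi_apply _) (measurable_pi_apply _)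

/-- If `A` is independent of `(Z, B)` and `Z` is independent of `B`, then `Z` is independent of
`(A, B)`: in both cases the joint law of `A, Z, B` is the product of the three laws. -/
lemma ProbabilityTheory.IndepFun.prodMk_of_indepFun {α β γ : Type*} [MeasurableSpace α]
    [MeasurableSpace β] [MeasurableSpace γ] [IsProbabilityMeasure P] {A : Ω → α} {Z : Ω → β}
    {B : Ω → γ} (hA : Measurable A) (hZ : Measurable Z) (hB : Measurable B)
    (h : IndepFun A (fun ω => (Z ω, B ω)) P) (h' : IndepFun Z B P) :
    IndepFun Z (fun ω => (A ω, B ω)) P := by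
  have hAB : IndepFun A B P := h.comp (φ := id) (ψ := Prod.snd) measurable_id measurable_snd
  have e1 := (indepFun_iff_map_prod_eq_prod_map_map hA.aemeasurable
    (hZ.prodMk hB).aemeasurable).1 h
  have e2 := (indepFun_iff_map_prod_eq_prod_map_map hZ.aemeasurable hB.aemeasurable).1 h'
  have e3 := (indepFun_iff_map_prod_eq_prod_map_map hA.aemeasurable hB.aemeasurable).1 hAB
  rw [indepFun_iff_map_prod_eq_prod_map_map hZ.aemeasurable (hA.prodMk hB).aemeasurable, e3]
  rw [e2] at e1
  have : IsProbabilityMeasure (P.map A) := Measure.isProbabilityMeasure_map hA.aemeasurable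
  have : IsProbabilityMeasure (P.map B) := Measure.isProbabilityMeasure_map hB.aemeasurable
  have : IsProbabilityMeasure (P.map Z) := Measure.isProbabilityMeasure_map hZ.aemeasurable
  have m1 := (measurePreserving_prodAssoc (P.map A) (P.map Z) (P.map B)).symm
  have m2 := (Measure.measurePreserving_swap (μ := P.map A) (ν := P.map Z)).prod
    (MeasurePreserving.id (P.map B))
  have m3 := measurePreserving_prodAssoc (P.map Z) (P.map A) (P.map B)
  have m := (m3.comp (m2.comp m1)).map_eq
  rw [← m, ← e1, Measure.map_map (m3.comp (m2.comp m1)).measurable (hA.prodMk (hZ.prodMk hB))]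
  rfl

/-- In an `M`-dependent sequence `X i` is independent of the whole family of the `X j` with
`|i - j| > M`, on both sides of `i` at once. -/
lemma IsMDependent.indepFun_sqDist [IsProbabilityMeasure P] (h : IsMDependent P M X)
    (hX : ∀ j, Measurable (X j)) (i : ℕ) (v : ℕ → ℝ) (s : Finset ℕ)
    (hs : Disjoint s (exclusionSet M i)) :
    IndepFun (X i) (sqDist X v s) P := by
  classical
  set s₁ := s.filter (fun j => j + M < i) with hs₁
  set s₂ := s.filter (fun j => ¬ j + M < i) with hs₂
  have hs₂' : ∀ j ∈ s₂, i + M + 1 ≤ j := by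
    intro j hj
    rw [hs₂, Finset.mem_filter] at hj
    have := Finset.disjoint_left.1 hs hj.1
    rw [exclusionSet, Finset.mem_Icc] at this
    omega
  have hB : ∀ k, k ≤ i + M + 1 → ∃ ψ : (Set.Ici k → ℝ) → ℝ, Measurable ψ ∧
      sqDist X v s₂ = ψ ∘ (fun ω (j : Set.Ici k) => X j ω) := by
    intro k hk
    refine ⟨fun f => ∑ j ∈ s₂.attach, (f ⟨j, hk.trans (hs₂' j j.2)⟩ - v j) ^ 2, by fun_prop, ?_⟩
    ext ω
    simp only [sqDist, Function.comp]
    rw [← Finset.sum_attach]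
  have hZB : IndepFun (X i) (sqDist X v s₂) P := by
    obtain ⟨ψ, hψ, e⟩ := hB _ le_rfl
    rw [e]
    exact (h i).comp (φ := fun f : Set.Iic i → ℝ => f ⟨i, Set.mem_Iic.2 le_rfl⟩)
      (measurable_pi_apply _) hψ
  have hA : IndepFun (sqDist X v s₁) (fun ω => (X i ω, sqDist X v s₂ ω)) P := by
    rcases lt_or_ge M i with hi | hi
    · have hle : i - M - 1 + M + 1 ≤ i := by omega
      obtain ⟨ψ, hψ, e⟩ := hB (i - M - 1 + M + 1) (by omega)
      have hm : ∀ j ∈ s₁, j ≤ i - M - 1 := by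
        intro j hj
        have := (Finset.mem_filter.1 hj).2
        omega
      have e₁ : sqDist X v s₁ = (fun f : Set.Iic (i - M - 1) → ℝ =>
          ∑ j ∈ s₁.attach, (f ⟨j, hm j j.2⟩ - v j) ^ 2) ∘
            (fun ω (j : Set.Iic (i - M - 1)) => X j ω) := by
        ext ω
        simp only [sqDist, Function.comp]
        rw [← Finset.sum_attach]
      have e₂ : (fun ω => (X i ω, sqDist X v s₂ ω)) =
          (fun f : Set.Ici (i - M - 1 + M + 1) → ℝ => (f ⟨i, hle⟩, ψ f)) ∘
            (fun ω (j : Set.Ici (i - M - 1 + M + 1)) => X j ω) := by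
        ext ω <;> simp [e]
      rw [e₁, e₂]
      exact (h (i - M - 1)).comp (by fun_prop) ((measurable_pi_apply _).prodMk hψ)
    · have : s₁ = ∅ := by
        rw [hs₁, Finset.filter_eq_empty_iff]
        intro j _
        omega
      have e₁ : sqDist X v s₁ = fun _ => 0 := by
        ext ω
        simp [sqDist, this]
      rw [e₁]
      exact indepFun_const_left 0 _
  have key := IndepFun.prodMk_of_indepFun (measurable_sqDist hX v s₁) (hX i)
    (measurable_sqDist hX v s₂) hA hZB
  have e : sqDist X v s = (fun x : ℝ × ℝ => x.1 + x.2) ∘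
      (fun ω => (sqDist X v s₁ ω, sqDist X v s₂ ω)) := by
    ext ω
    simp only [sqDist, Function.comp, hs₁, hs₂]
    rw [Finset.sum_filter_add_sum_filter_not]
  rw [e]
  exact key.comp (φ := id) measurable_id (by fun_prop)

lemma IsMDependent.lintegral_prod_eq [IsProbabilityMeasure P] (h : IsMDependent P M X)
    (hX : ∀ j, Measurable (X j)) (φ : ℕ → ℝ → ENNReal) (hφ : ∀ l, Measurable (φ l)) (j : ℕ → ℕ)
    (hj : ∀ l, j l + M < j (l + 1)) (n : ℕ) :
    ∫⁻ ω, ∏ l ∈ Finset.range n, φ l (X (j l) ω) ∂P =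
      ∏ l ∈ Finset.range n, ∫⁻ ω, φ l (X (j l) ω) ∂P := by
  have hmono : StrictMono j := strictMono_nat_of_lt_succ fun l => by
    have := hj l
    omega
  induction n with
  | zero => simp
  | succ n ih =>
    rw [Finset.prod_range_succ, ← ih]
    simp_rw [Finset.prod_range_succ]
    refine lintegral_mul_eq_lintegral_mul_lintegral_of_indepFun'' ?_ ?_ ?_
    · exact (Finset.measurable_prod _ fun l _ => (hφ l).comp (hX _)).aemeasurable
    · exact ((hφ n).comp (hX _)).aemeasurable
    rcases n with _ | n
    · simp only [Finset.range_zero, Finset.prod_empty]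
      exact indepFun_const_left 1 _
    have hm : ∀ l ∈ Finset.range (n + 1), j l ≤ j n := fun l hl =>
      hmono.monotone (Nat.lt_succ_iff.1 (Finset.mem_range.1 hl))
    have e : (fun ω => ∏ l ∈ Finset.range (n + 1), φ l (X (j l) ω)) =
        (fun f : Set.Iic (j n) → ℝ => ∏ l ∈ (Finset.range (n + 1)).attach,
          φ l (f ⟨j l, hm l l.2⟩)) ∘ (fun ω (i : Set.Iic (j n)) => X i ω) := by
      ext ω
      simp only [Function.comp]
      rw [← Finset.prod_attach]
    rw [e]
    refine (h (j n)).comp (φ := _) (ψ := fun f => φ (n + 1) (f ⟨j (n + 1), hj n⟩)) ?_ ?_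
    · exact Finset.measurable_prod _ fun l _ => (hφ l).comp (measurable_pi_apply _)
    · exact (hφ _).comp (measurable_pi_apply _)

end Independence

/-! ### Negative moments of the squared distance -/

section NegativeMoments

open scoped ENNReal

lemma lintegral_inv_sqrt_abs_lt_top :
    ∫⁻ x in Set.Ioo (-1 : ℝ) 1, ENNReal.ofReal (1 / √|x|) < ⊤ := by
  have h1 : IntervalIntegrable (fun x : ℝ => 1 / √|x|) volume 0 1 := by
    have := intervalIntegral.intervalIntegrable_rpow' (a := 0) (b := 1) (r := -(1 / 2))
      (by norm_num)
    refine this.congr ?_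
    intro x hx
    rw [Set.uIoc_of_le zero_le_one] at hx
    simp only
    rw [abs_of_pos hx.1, Real.rpow_neg hx.1.le, ← Real.sqrt_eq_rpow, one_div]
  have h2 : IntervalIntegrable (fun x : ℝ => 1 / √|x|) volume (-1) 0 := by
    have := (IntervalIntegrable.iff_comp_neg (by simp)).1 h1
    simpa using this.symm
  have h3 := h2.trans h1
  rw [intervalIntegrable_iff_integrableOn_Ioo_of_le (by norm_num)] at h3
  exact h3.lintegral_lt_top

/-- A random variable with density bounded by `c` satisfies `E |Y - v|^{-1/2} ≤ K` with `K`
depending only on `c`. -/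
lemma exists_lintegral_inv_sqrt_abs_sub_le (c : ℝ) : ∃ K : ℝ≥0∞, K < ⊤ ∧
    ∀ {Ω : Type*} [MeasurableSpace Ω] (P : Measure Ω) [IsProbabilityMeasure P] (Y : Ω → ℝ),
      HasPDF Y P volume → (∀ᵐ x : ℝ, pdf Y P volume x ≤ ENNReal.ofReal c) →
      ∀ v : ℝ, ∫⁻ ω, ENNReal.ofReal (1 / √|Y ω - v|) ∂P ≤ K := by
  set I := ∫⁻ x in Set.Ioo (-1 : ℝ) 1, ENNReal.ofReal (1 / √|x|) with hI
  refine ⟨1 + ENNReal.ofReal c * I, ?_, ?_⟩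
  · exact ENNReal.add_lt_top.2 ⟨ENNReal.one_lt_top,
      ENNReal.mul_lt_top ENNReal.ofReal_lt_top lintegral_inv_sqrt_abs_lt_top⟩
  intro Ω _ P _ Y hY hc v
  set g : ℝ → ℝ≥0∞ := (Set.Ioo (-1 : ℝ) 1).indicator (fun x => ENNReal.ofReal (1 / √|x|)) with hg
  have hgm : Measurable g := by
    refine Measurable.indicator ?_ measurableSet_Ioo
    fun_prop
  have hgv : Measurable fun x => g (x - v) := hgm.comp (by fun_prop)
  have hpt : ∀ x : ℝ, ENNReal.ofReal (1 / √|x|) ≤ 1 + g x := by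
    intro x
    by_cases hx : x ∈ Set.Ioo (-1 : ℝ) 1
    · rw [hg, Set.indicator_of_mem hx]
      exact le_add_self
    · refine le_trans ?_ le_self_add
      rw [ENNReal.ofReal_le_one]
      have : 1 ≤ |x| := by
        by_contra! h
        exact hx (abs_lt.1 h)
      rw [div_le_one (by positivity)]
      exact Real.one_le_sqrt.2 this
  calc ∫⁻ ω, ENNReal.ofReal (1 / √|Y ω - v|) ∂P
      ≤ ∫⁻ ω, (1 + g (Y ω - v)) ∂P := lintegral_mono fun ω => hpt _
    _ = 1 + ∫⁻ ω, g (Y ω - v) ∂P := by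
        rw [lintegral_add_left measurable_const]
        simp
    _ = 1 + ∫⁻ x, pdf Y P volume x * g (x - v) := by
        rw [pdf.lintegral_pdf_mul hgv.aemeasurable]
    _ ≤ 1 + ∫⁻ x, ENNReal.ofReal c * g (x - v) := by
        gcongr 1 + ?_
        refine lintegral_mono_ae ?_
        filter_upwards [hc] with x hx
        gcongr
    _ = 1 + ENNReal.ofReal c * I := by
        rw [lintegral_const_mul _ hgv, lintegral_sub_right_eq_self g v, hg,
          lintegral_indicator measurableSet_Ioo]

/-- The `4k`-fold product bound `(∑ x_l²)^{-k} ≤ ∏ |x_l|^{-1/2}`. -/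
lemma inv_sum_sq_pow_le_prod (k : ℕ) (x : ℕ → ℝ) (hx : ∀ l, x l ≠ 0) :
    ((∑ l ∈ Finset.range (4 * k), x l ^ 2)⁻¹) ^ k ≤
      ∏ l ∈ Finset.range (4 * k), 1 / √|x l| := by
  set b := ∑ l ∈ Finset.range (4 * k), x l ^ 2 with hb
  have hb0 : 0 ≤ b := Finset.sum_nonneg fun _ _ => sq_nonneg _
  have h4 : ∀ y : ℝ, 0 ≤ y → √(√y) ^ 4 = y := fun y hy => by
    rw [show (4 : ℕ) = 2 * 2 by rfl, pow_mul, Real.sq_sqrt (Real.sqrt_nonneg _), Real.sq_sqrt hy]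
  have hle : ∏ l ∈ Finset.range (4 * k), √|x l| ≤ b ^ k := by
    calc ∏ l ∈ Finset.range (4 * k), √|x l| ≤ ∏ l ∈ Finset.range (4 * k), √(√b) := by
          refine Finset.prod_le_prod (fun _ _ => Real.sqrt_nonneg _) fun l hl => ?_
          refine Real.sqrt_le_sqrt ?_
          rw [← Real.sqrt_sq_eq_abs]
          exact Real.sqrt_le_sqrt
            (Finset.single_le_sum (f := fun l => x l ^ 2) (fun _ _ => sq_nonneg _) hl)
      _ = b ^ k := by
          rw [Finset.prod_const, Finset.card_range, pow_mul, h4 b hb0]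
  have hpos : 0 < ∏ l ∈ Finset.range (4 * k), √|x l| :=
    Finset.prod_pos fun l _ => Real.sqrt_pos.2 (abs_pos.2 (hx l))
  rw [inv_pow, Finset.prod_div_distrib, Finset.prod_const_one, ← one_div]
  exact one_div_le_one_div_of_le hpos hle

/-- Deterministic core of the negative moment bound. The first `p` indices are cut into blocks
containing `4k` indices that are `M + 1` apart; the blocks in `G` avoid the removed set `E`, and
Jensen's inequality for `x ↦ x^{-k}` distributes the negative power over these blocks. -/
lemma div_sum_sq_pow_le (M k e p : ℕ) (hk : 0 < k) (E : Finset ℕ) (hE : E.card ≤ e)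
    (hp : 4 * k * (M + 1) * (2 * e + 2) ≤ p) :
    ∃ G : Finset ℕ, G.Nonempty ∧ ∀ x : ℕ → ℝ, (∀ j, x j ≠ 0) →
      0 < ∑ j ∈ Finset.range p \ E, x j ^ 2 ∧
      ((p : ℝ) / ∑ j ∈ Finset.range p \ E, x j ^ 2) ^ k ≤
        (2 * (4 * k * (M + 1) : ℕ) : ℝ) ^ k * (∑ b ∈ G, (1 / (G.card : ℝ)) *
          ∏ l ∈ Finset.range (4 * k), 1 / √|x ((b * (4 * k) + l) * (M + 1))|) := by
  classical
  set L := 4 * k * (M + 1) with hL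
  have hLpos : 0 < L := by positivity
  set G := Finset.range (p / L) \ E.image (· / L) with hG
  have hdiv : 2 * e + 2 ≤ p / L := (Nat.le_div_iff_mul_le hLpos).2 (by rw [mul_comm]; exact hp)
  have hcard : p / L - e ≤ G.card := by
    have h1 := Finset.le_card_sdiff (E.image (· / L)) (Finset.range (p / L))
    have h2 : (E.image (· / L)).card ≤ e := Finset.card_image_le.trans hE
    rw [Finset.card_range] at h1
    exact le_trans (by omega) h1
  have hpos : 0 < G.card := by omega
  have hpG : p ≤ 2 * L * G.card := by
    have h1 : p < L * (p / L + 1) := by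
      have := Nat.lt_mul_div_succ p hLpos
      simpa using this
    have h2 : p / L + 1 ≤ 2 * G.card := by omega
    calc p ≤ L * (p / L + 1) := h1.le
      _ ≤ L * (2 * G.card) := Nat.mul_le_mul_left _ h2
      _ = 2 * L * G.card := by ring
  refine ⟨G, Finset.card_pos.1 hpos, fun x hx => ?_⟩
  set f : ℕ × ℕ → ℕ := fun a => (a.1 * (4 * k) + a.2) * (M + 1) with hf
  set B : ℕ → ℝ := fun b => ∑ l ∈ Finset.range (4 * k), x (f (b, l)) ^ 2 with hB
  have hBpos : ∀ b, 0 < B b := fun b =>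
    Finset.sum_pos (fun l _ => by have := hx (f (b, l)); positivity) ⟨0, by simp [hk]⟩
  have hinj : Set.InjOn f (G ×ˢ Finset.range (4 * k) : Finset (ℕ × ℕ)) := by
    rintro ⟨b, l⟩ h1 ⟨b', l'⟩ h2 h
    simp only [Finset.coe_product, Set.mem_prod, Finset.mem_coe, Finset.mem_range] at h1 h2
    have h3 : b * (4 * k) + l = b' * (4 * k) + l' := Nat.eq_of_mul_eq_mul_right (by omega) h
    have h4 : (b * (4 * k) + l) / (4 * k) = b := by
      rw [mul_comm, Nat.mul_add_div (by omega), Nat.div_eq_of_lt h1.2, add_zero]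
    have h5 : (b' * (4 * k) + l') / (4 * k) = b' := by
      rw [mul_comm, Nat.mul_add_div (by omega), Nat.div_eq_of_lt h2.2, add_zero]
    have h6 : b = b' := by rw [← h4, h3, h5]
    subst h6
    simp only [Prod.mk.injEq, true_and]
    omega
  have hsub : (G ×ˢ Finset.range (4 * k)).image f ⊆ Finset.range p \ E := by
    intro j hj
    obtain ⟨⟨b, l⟩, hbl, rfl⟩ := Finset.mem_image.1 hj
    obtain ⟨hb, hl⟩ := Finset.mem_product.1 hbl
    simp only [Finset.mem_range] at hl hb
    rw [hG, Finset.mem_sdiff, Finset.mem_range] at hb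
    have e1 : f (b, l) = L * b + l * (M + 1) := by simp only [hf, hL]; ring
    have e2 : l * (M + 1) < L := by
      rw [hL]
      exact Nat.mul_lt_mul_of_pos_right hl (by omega)
    have e3 : f (b, l) / L = b := by
      rw [e1, Nat.mul_add_div hLpos, Nat.div_eq_of_lt e2, add_zero]
    rw [Finset.mem_sdiff, Finset.mem_range]
    refine ⟨?_, fun hE' => hb.2 (Finset.mem_image.2 ⟨_, hE', e3⟩)⟩
    by_contra! hge
    have := Nat.div_le_div_right (c := L) hge
    omega
  have hsum : ∑ b ∈ G, B b ≤ ∑ j ∈ Finset.range p \ E, x j ^ 2 := by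
    calc ∑ b ∈ G, B b = ∑ a ∈ G ×ˢ Finset.range (4 * k), x (f a) ^ 2 := by
          rw [Finset.sum_product]
      _ = ∑ j ∈ (G ×ˢ Finset.range (4 * k)).image f, x j ^ 2 :=
          (Finset.sum_image (f := fun j => x j ^ 2) hinj).symm
      _ ≤ _ := Finset.sum_le_sum_of_subset_of_nonneg hsub fun _ _ _ => sq_nonneg _
  have hsB : 0 < ∑ b ∈ G, B b := Finset.sum_pos (fun b _ => hBpos b) (Finset.card_pos.1 hpos)
  have hN := hsB.trans_le hsum
  refine ⟨hN, ?_⟩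
  have hGr : (0 : ℝ) < G.card := by exact_mod_cast hpos
  have hLr : (0 : ℝ) < L := by exact_mod_cast hLpos
  have hpGr : (p : ℝ) ≤ 2 * L * G.card := by exact_mod_cast hpG
  set A := ∑ b ∈ G, (1 / (G.card : ℝ)) * B b with hA
  have hAe : A = (∑ b ∈ G, B b) / G.card := by
    rw [hA, ← Finset.mul_sum]
    ring
  have hApos : 0 < A := by rw [hAe]; positivity
  have jensen := (convexOn_zpow (𝕜 := ℝ) (-(k : ℤ))).map_sum_le (t := G)
    (w := fun _ => 1 / (G.card : ℝ)) (p := B) (fun _ _ => by positivity)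
    (by rw [Finset.sum_const, nsmul_eq_mul]; field_simp) (fun b _ => hBpos b)
  simp only [smul_eq_mul, zpow_neg, zpow_natCast] at jensen
  calc ((p : ℝ) / ∑ j ∈ Finset.range p \ E, x j ^ 2) ^ k
      ≤ ((2 * L * G.card) / ∑ b ∈ G, B b) ^ k := by gcongr
    _ = (2 * L : ℝ) ^ k * (A ^ k)⁻¹ := by
        rw [hAe, ← inv_pow, ← mul_pow]
        congr 1
        field_simp
    _ ≤ (2 * L : ℝ) ^ k * (∑ b ∈ G, (1 / (G.card : ℝ)) *
          ∏ l ∈ Finset.range (4 * k), 1 / √|x ((b * (4 * k) + l) * (M + 1))|) := by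
        gcongr
        refine jensen.trans (Finset.sum_le_sum fun b _ => ?_)
        gcongr
        rw [← inv_pow]
        exact inv_sum_sq_pow_le_prod k (fun l => x (f (b, l))) fun l => hx _

variable {Ω : Type*} [MeasurableSpace Ω] {P : Measure Ω} {M : ℕ} {q c σmin C : ℝ}
  {X : ℕ → Ω → ℝ}

lemma ClassD.ae_ne (h : ClassD P M q c σmin C X) (v : ℕ → ℝ) :
    ∀ᵐ ω ∂P, ∀ j, X j ω - v j ≠ 0 := by
  rw [ae_all_iff]
  intro j
  have := (h.hasPDF j).absolutelyContinuous
  have h0 : P.map (X j) {v j} = 0 := this (by simp)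
  rw [Measure.map_apply (h.measurable j) (measurableSet_singleton _)] at h0
  rw [ae_iff]
  convert h0 using 2
  ext ω
  simp [sub_eq_zero]

/-- Uniform bound on all negative moments of `‖(X_j - v_j)_{j < p, j ∉ E}‖² / p`, over all centres
`v` and all removed sets `E` of bounded size. -/
theorem ClassD.exists_negMoment_bound [IsProbabilityMeasure P] (h : ClassD P M q c σmin C X)
    (k e : ℕ) (hk : 0 < k) : ∃ (B : ℝ) (p₀ : ℕ), ∀ p ≥ p₀, ∀ E : Finset ℕ, E.card ≤ e →
      ∀ v : ℕ → ℝ, (∀ᵐ ω ∂P, 0 < sqDist X v (Finset.range p \ E) ω) ∧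
        Integrable (fun ω => ((p : ℝ) / sqDist X v (Finset.range p \ E) ω) ^ k) P ∧
        ∫ ω, ((p : ℝ) / sqDist X v (Finset.range p \ E) ω) ^ k ∂P ≤ B := by
  obtain ⟨K, hK, hKb⟩ := exists_lintegral_inv_sqrt_abs_sub_le c
  set D : ℝ≥0∞ := ENNReal.ofReal ((2 * (4 * k * (M + 1) : ℕ) : ℝ) ^ k) * K ^ (4 * k) with hD
  have hDtop : D < ⊤ := ENNReal.mul_lt_top ENNReal.ofReal_lt_top (ENNReal.pow_lt_top hK)
  refine ⟨D.toReal, 4 * k * (M + 1) * (2 * e + 2), fun p hp E hE v => ?_⟩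
  obtain ⟨G, hGne, hG⟩ := div_sum_sq_pow_le M k e p hk E hE hp
  have hpos : ∀ᵐ ω ∂P, 0 < sqDist X v (Finset.range p \ E) ω := by
    filter_upwards [h.ae_ne v] with ω hω
    exact (hG _ hω).1
  have hmeas : Measurable (fun ω => ((p : ℝ) / sqDist X v (Finset.range p \ E) ω) ^ k) :=
    (measurable_const.div (measurable_sqDist h.measurable _ _)).pow_const _
  have hnn : ∀ ω, 0 ≤ ((p : ℝ) / sqDist X v (Finset.range p \ E) ω) ^ k := fun ω =>
    pow_nonneg (div_nonneg (Nat.cast_nonneg _) (sqDist_nonneg _ _ _)) _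
  have hGr : (0 : ℝ) < G.card := by exact_mod_cast Finset.card_pos.2 hGne
  have hbound : ∫⁻ ω, ENNReal.ofReal (((p : ℝ) / sqDist X v (Finset.range p \ E) ω) ^ k) ∂P
      ≤ D := by
    calc _ ≤ ∫⁻ ω, ENNReal.ofReal ((2 * (4 * k * (M + 1) : ℕ) : ℝ) ^ k) *
          ∑ b ∈ G, ENNReal.ofReal (1 / (G.card : ℝ)) * ∏ l ∈ Finset.range (4 * k),
            ENNReal.ofReal (1 / √|X ((b * (4 * k) + l) * (M + 1)) ω -
              v ((b * (4 * k) + l) * (M + 1))|) ∂P := by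
          refine lintegral_mono_ae ?_
          filter_upwards [h.ae_ne v] with ω hω
          refine (ENNReal.ofReal_le_ofReal (hG _ hω).2).trans_eq ?_
          rw [ENNReal.ofReal_mul (by positivity), ENNReal.ofReal_sum_of_nonneg
            (fun b _ => by positivity)]
          congr 1
          refine Finset.sum_congr rfl fun b _ => ?_
          rw [ENNReal.ofReal_mul (by positivity),
            ENNReal.ofReal_prod_of_nonneg (fun l _ => by positivity)]
      _ = ENNReal.ofReal ((2 * (4 * k * (M + 1) : ℕ) : ℝ) ^ k) *
          ∑ b ∈ G, ENNReal.ofReal (1 / (G.card : ℝ)) * ∏ l ∈ Finset.range (4 * k),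
            ∫⁻ ω, ENNReal.ofReal (1 / √|X ((b * (4 * k) + l) * (M + 1)) ω -
              v ((b * (4 * k) + l) * (M + 1))|) ∂P := by
          have hmφ : ∀ j, Measurable fun x : ℝ => ENNReal.ofReal (1 / √|x - v j|) := fun j => by
            fun_prop
          have hmω : ∀ j, Measurable fun ω => ENNReal.ofReal (1 / √|X j ω - v j|) := fun j =>
            (hmφ j).comp (h.measurable j)
          rw [lintegral_const_mul, lintegral_finsetSum]
          · congr 1
            refine Finset.sum_congr rfl fun b _ => ?_
            rw [lintegral_const_mul _ (Finset.measurable_prod _ fun l _ => hmω _)]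
            congr 1
            refine h.mDependent.lintegral_prod_eq h.measurable _ (fun l => hmφ _)
              (fun l => (b * (4 * k) + l) * (M + 1)) (fun l => ?_) _
            have : (b * (4 * k) + (l + 1)) * (M + 1) =
              (b * (4 * k) + l) * (M + 1) + (M + 1) := by ring
            omega
          · exact fun b _ => (Finset.measurable_prod _ fun l _ => hmω _).const_mul _
          · exact Finset.measurable_sum _ fun b _ =>
              (Finset.measurable_prod _ fun l _ => hmω _).const_mul _
      _ ≤ ENNReal.ofReal ((2 * (4 * k * (M + 1) : ℕ) : ℝ) ^ k) *
          ∑ b ∈ G, ENNReal.ofReal (1 / (G.card : ℝ)) * ∏ l ∈ Finset.range (4 * k), K := by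
          gcongr with b _ l _
          exact hKb P _ (h.hasPDF _) (h.pdf_le _) _
      _ = D := by
          rw [hD]
          congr 1
          simp only [Finset.prod_const, Finset.card_range, Finset.sum_const, nsmul_eq_mul]
          rw [← mul_assoc, ← ENNReal.ofReal_natCast, ← ENNReal.ofReal_mul hGr.le,
            mul_one_div_cancel hGr.ne', ENNReal.ofReal_one, one_mul]
  refine ⟨hpos, ⟨hmeas.aestronglyMeasurable, ?_⟩, ?_⟩
  · rw [hasFiniteIntegral_iff_ofReal (ae_of_all _ hnn)]
    exact hbound.trans_lt hDtop
  · rw [integral_eq_lintegral_of_nonneg_ae (ae_of_all _ hnn) hmeas.aestronglyMeasurable]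
    exact ENNReal.toReal_mono hDtop.ne hbound

end NegativeMoments

/-! ### Moments of the centred sequence -/

section Moments

variable {Ω : Type*} [MeasurableSpace Ω] {P : Measure Ω} {M : ℕ} {q c σmin C : ℝ}
  {X : ℕ → Ω → ℝ}

/-- The centred variable `X j - E[X j]`. -/
noncomputable def centered (P : Measure Ω) (X : ℕ → Ω → ℝ) (j : ℕ) (ω : Ω) : ℝ :=
  X j ω - ∫ ω', X j ω' ∂P

lemma rpow_abs_le_one_add {r q : ℝ} (hr : 0 ≤ r) (hrq : r ≤ q) (x : ℝ) :
    |x| ^ r ≤ 1 + |x| ^ q := by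
  have h0 : 0 ≤ |x| ^ q := Real.rpow_nonneg (abs_nonneg x) q
  rcases le_total |x| 1 with h | h
  · have := Real.rpow_le_one (abs_nonneg x) h hr
    linarith
  · have := Real.rpow_le_rpow_of_exponent_le h hrq
    linarith

lemma pow_abs_le_one_add {n : ℕ} {q : ℝ} (hq : n ≤ q) (x : ℝ) : |x| ^ n ≤ 1 + |x| ^ q := by
  have := rpow_abs_le_one_add (Nat.cast_nonneg n) hq x
  rwa [Real.rpow_natCast] at this

namespace ClassD

lemma measurable_centered (h : ClassD P M q c σmin C X) (j : ℕ) : Measurable (centered P X j) :=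
  (h.measurable j).sub_const _

lemma integrable_abs_rpow_centered (h : ClassD P M q c σmin C X) (j : ℕ) :
    Integrable (fun ω => |centered P X j ω| ^ q) P :=
  h.integrable_abs_sub_pow j

lemma integral_abs_rpow_centered_le (h : ClassD P M q c σmin C X) (j : ℕ) :
    ∫ ω, |centered P X j ω| ^ q ∂P ≤ C :=
  h.abs_sub_pow_le j

lemma variance_eq (h : ClassD P M q c σmin C X) (j : ℕ) :
    variance (X j) P = ∫ ω, centered P X j ω ^ 2 ∂P :=
  variance_eq_integral (h.measurable j).aemeasurable

lemma sq_le_variance (h : ClassD P M q c σmin C X) (j : ℕ) : σmin ^ 2 ≤ variance (X j) P := by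
  have := pow_le_pow_left₀ h.σmin_pos.le (h.le_sd j) 2
  rwa [Real.sq_sqrt (variance_nonneg _ _)] at this

variable [IsProbabilityMeasure P]

lemma integrable (h : ClassD P M q c σmin C X) (j : ℕ) : Integrable (X j) P := by
  refine ((integrable_const 1).add (h.integrable_abs_pow j)).mono'
    (h.measurable j).aestronglyMeasurable (ae_of_all _ fun ω => ?_)
  have := pow_abs_le_one_add (n := 1) (q := q) (by have := h.two_le_q; norm_num; linarith) (X j ω)
  simpa using this

lemma integrable_centered (h : ClassD P M q c σmin C X) (j : ℕ) :
    Integrable (centered P X j) P :=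
  (h.integrable j).sub (integrable_const _)

lemma integral_centered (h : ClassD P M q c σmin C X) (j : ℕ) :
    ∫ ω, centered P X j ω ∂P = 0 := by
  simp only [centered]
  rw [integral_sub (h.integrable j) (integrable_const _)]
  simp

lemma integrable_centered_sq (h : ClassD P M q c σmin C X) (j : ℕ) :
    Integrable (fun ω => centered P X j ω ^ 2) P := by
  refine ((integrable_const 1).add (h.integrable_abs_sub_pow j)).mono'
    ((h.measurable_centered j).pow_const 2).aestronglyMeasurable (ae_of_all _ fun ω => ?_)
  have := pow_abs_le_one_add (n := 2) (q := q) (by exact_mod_cast h.two_le_q) (centered P X j ω)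
  simpa [centered] using this

lemma integral_centered_sq_le (h : ClassD P M q c σmin C X) (j : ℕ) :
    ∫ ω, centered P X j ω ^ 2 ∂P ≤ 1 + C := by
  calc ∫ ω, centered P X j ω ^ 2 ∂P ≤ ∫ ω, (1 + |centered P X j ω| ^ q) ∂P := by
        refine integral_mono (h.integrable_centered_sq j)
          ((integrable_const 1).add (h.integrable_abs_rpow_centered j)) fun ω => ?_
        have := pow_abs_le_one_add (n := 2) (q := q) (by exact_mod_cast h.two_le_q)
          (centered P X j ω)
        simpa using this
    _ ≤ 1 + C := by
        rw [integral_add (integrable_const 1) (h.integrable_abs_rpow_centered j)]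
        simpa using h.integral_abs_rpow_centered_le j

end ClassD

end Moments

/-! ### Existence, uniqueness and first-order condition for geometric medians -/

section GeometricMedian

variable {Ω : Type*} [MeasurableSpace Ω] {P : Measure Ω} [IsProbabilityMeasure P] {p : ℕ}
  {Y : Ω → EuclideanSpace ℝ (Fin p)}

lemma integrable_norm_sub (hY : Integrable Y P) (v : EuclideanSpace ℝ (Fin p)) :
    Integrable (fun ω => ‖Y ω - v‖) P :=
  (hY.sub (integrable_const v)).norm

lemma exists_isGeometricMedian (hY : Integrable Y P) : ∃ v, IsGeometricMedian P Y v := by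
  refine Continuous.exists_forall_le (f := fun v => ∫ ω, ‖Y ω - v‖ ∂P) ?_ ?_
  · have : LipschitzWith 1 (fun v => ∫ ω, ‖Y ω - v‖ ∂P) := by
      refine LipschitzWith.of_dist_le_mul fun v w => ?_
      rw [Real.dist_eq, ← integral_sub (integrable_norm_sub hY v) (integrable_norm_sub hY w),
        NNReal.coe_one, one_mul]
      refine abs_integral_le_integral_abs.trans ?_
      calc ∫ ω, |‖Y ω - v‖ - ‖Y ω - w‖| ∂P ≤ ∫ _, dist v w ∂P := by
            refine integral_mono ((integrable_norm_sub hY v).sub (integrable_norm_sub hY w)).abs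
              (integrable_const _) fun ω => ?_
            refine (abs_norm_sub_norm_le _ _).trans_eq ?_
            rw [dist_eq_norm, sub_sub_sub_cancel_left, norm_sub_rev]
        _ = dist v w := by simp
    exact this.continuous
  · refine tendsto_atTop_mono (f := fun v => ‖v‖ - ∫ ω, ‖Y ω‖ ∂P) (fun v => ?_) ?_
    · have : ∫ ω, (‖v‖ - ‖Y ω‖) ∂P ≤ ∫ ω, ‖Y ω - v‖ ∂P :=
        integral_mono ((integrable_const _).sub hY.norm) (integrable_norm_sub hY v) fun ω => by
          rw [norm_sub_rev]
          exact norm_sub_norm_le _ _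
      rw [integral_sub (integrable_const _) hY.norm] at this
      simpa using this
    · exact tendsto_atTop_add_const_right _ _ (tendsto_norm_cocompact_atTop)

/-- If `v` and `w` both minimize `E ‖Y - ·‖`, then so does their midpoint, and equality in the
triangle inequality forces `Y - v` and `Y - w` to be almost surely collinear. -/
lemma IsGeometricMedian.ae_collinear (hY : Integrable Y P) {v w : EuclideanSpace ℝ (Fin p)}
    (hv : IsGeometricMedian P Y v) (hw : IsGeometricMedian P Y w) :
    ∀ᵐ ω ∂P, ∀ k l, (w k - v k) * (Y ω l - v l) = (w l - v l) * (Y ω k - v k) := by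
  set u := (1 / 2 : ℝ) • (v + w) with hu
  have hpt : ∀ ω, Y ω - u = (1 / 2 : ℝ) • ((Y ω - v) + (Y ω - w)) := fun ω => by
    rw [hu]
    module
  have hnorm : ∀ ω, ‖Y ω - u‖ = (1 / 2) * ‖(Y ω - v) + (Y ω - w)‖ := fun ω => by
    rw [hpt, norm_smul]
    norm_num
  have hadd : Integrable (fun ω => ‖Y ω - v‖ + ‖Y ω - w‖) P :=
    (integrable_norm_sub hY v).add (integrable_norm_sub hY w)
  have hnadd : Integrable (fun ω => ‖(Y ω - v) + (Y ω - w)‖) P :=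
    ((hY.sub (integrable_const v)).add (hY.sub (integrable_const w))).norm
  have hint : Integrable (fun ω => ‖Y ω - v‖ + ‖Y ω - w‖ - ‖(Y ω - v) + (Y ω - w)‖) P :=
    hadd.sub hnadd
  have hzero : ∫ ω, (‖Y ω - v‖ + ‖Y ω - w‖ - ‖(Y ω - v) + (Y ω - w)‖) ∂P = 0 := by
    refine le_antisymm ?_ (integral_nonneg fun ω => sub_nonneg.2 (norm_add_le _ _))
    have e : ∫ ω, ‖Y ω - u‖ ∂P = (1 / 2) * ∫ ω, ‖(Y ω - v) + (Y ω - w)‖ ∂P := by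
      simp_rw [hnorm]
      rw [integral_const_mul]
    have h1 := hv u
    have h2 := hw u
    rw [integral_sub hadd hnadd,
      integral_add (integrable_norm_sub hY v) (integrable_norm_sub hY w)]
    linarith
  rw [integral_eq_zero_iff_of_nonneg (fun ω => sub_nonneg.2 (norm_add_le _ _)) hint] at hzero
  filter_upwards [hzero] with ω hω
  have hray : SameRay ℝ (Y ω - v) (Y ω - w) := by
    rw [sameRay_iff_norm_add]
    simp only [Pi.zero_apply] at hω
    linarith
  have hcross : ∀ k l, (Y ω - v) k * (Y ω - w) l = (Y ω - v) l * (Y ω - w) k := by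
    intro k l
    rcases hray with h0 | h0 | ⟨r₁, r₂, hr₁, hr₂, he⟩
    · simp [h0]
    · simp [h0]
    · have e : ∀ k, r₁ * (Y ω - v) k = r₂ * (Y ω - w) k := fun k => by
        have := congrArg (fun z : EuclideanSpace ℝ (Fin p) => z k) he
        simpa using this
      have : r₂ * ((Y ω - v) k * (Y ω - w) l) = r₂ * ((Y ω - v) l * (Y ω - w) k) := by
        linear_combination (-(Y ω - v) k) * e l + (Y ω - v) l * e k
      exact mul_left_cancel₀ hr₂.ne' this
  intro k l
  have := hcross k l
  simp only [PiLp.sub_apply] at this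
  linarith

lemma hasDerivAt_norm_sub_smul {E : Type*} [NormedAddCommGroup E] [InnerProductSpace ℝ E]
    (u e : E) (hu : u ≠ 0) :
    HasDerivAt (fun t : ℝ => ‖u - t • e‖) (-(inner ℝ u e / ‖u‖)) 0 := by
  have h1 : HasDerivAt (fun t : ℝ => u - t • e) (-e) 0 := by
    simpa using ((hasDerivAt_id (0 : ℝ)).smul_const e).const_sub u
  have h2 := h1.norm_sq.sqrt (by simpa using hu)
  have e1 : (fun t : ℝ => √(‖u - t • e‖ ^ 2)) = fun t : ℝ => ‖u - t • e‖ := by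
    ext t
    exact Real.sqrt_sq (norm_nonneg _)
  rw [e1] at h2
  convert h2 using 1
  simp only [zero_smul, sub_zero, Real.sqrt_sq (norm_nonneg _), inner_neg_right]
  have : ‖u‖ ≠ 0 := norm_ne_zero_iff.2 hu
  field_simp

lemma IsGeometricMedian.integral_div_norm_eq_zero (hY : Integrable Y P)
    {v : EuclideanSpace ℝ (Fin p)} (hv : IsGeometricMedian P Y v) (hne : ∀ᵐ ω ∂P, Y ω ≠ v)
    (i : Fin p) : ∫ ω, (Y ω i - v i) / ‖Y ω - v‖ ∂P = 0 := by
  set e : EuclideanSpace ℝ (Fin p) := EuclideanSpace.single i (1 : ℝ) with he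
  have hint : ∀ t : ℝ, Integrable (fun ω => ‖Y ω - v - t • e‖) P := fun t => by
    have := integrable_norm_sub hY (v + t • e)
    simpa only [sub_sub] using this
  have hmeas : AEStronglyMeasurable (fun ω => -(inner ℝ (Y ω - v) e / ‖Y ω - v‖)) P := by
    have h1 : AEStronglyMeasurable (fun ω => Y ω - v) P :=
      hY.aestronglyMeasurable.sub aestronglyMeasurable_const
    exact ((h1.inner aestronglyMeasurable_const).aemeasurable.div
      h1.norm.aemeasurable).neg.aestronglyMeasurable
  have key := hasDerivAt_integral_of_dominated_loc_of_lip (μ := P) (𝕜 := ℝ) (x₀ := (0 : ℝ))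
    (F := fun t ω => ‖Y ω - v - t • e‖) (F' := fun ω => -(inner ℝ (Y ω - v) e / ‖Y ω - v‖))
    (bound := fun _ => ‖e‖) univ_mem
    (Eventually.of_forall fun t => (hint t).aestronglyMeasurable) (hint 0) hmeas
    (ae_of_all _ fun ω => by
      refine LipschitzOnWith.of_dist_le_mul fun s _ t _ => ?_
      rw [Real.dist_eq, Real.dist_eq, Real.coe_nnabs, abs_norm]
      refine (abs_norm_sub_norm_le _ _).trans_eq ?_
      rw [sub_sub_sub_cancel_left, ← sub_smul, norm_smul, Real.norm_eq_abs, abs_sub_comm, mul_comm])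
    (integrable_const _)
    (by
      filter_upwards [hne] with ω hω
      exact hasDerivAt_norm_sub_smul _ _ (sub_ne_zero.2 hω))
  have hmin : IsLocalMin (fun t : ℝ => ∫ ω, ‖Y ω - v - t • e‖ ∂P) 0 := by
    refine Eventually.of_forall fun t => ?_
    have := hv (v + t • e)
    simpa [sub_sub] using this
  have h0 := hmin.hasDerivAt_eq_zero key.2
  rw [integral_neg, neg_eq_zero] at h0
  rw [← h0]
  refine integral_congr_ae (ae_of_all _ fun ω => ?_)
  simp [he, EuclideanSpace.inner_single_right]

end GeometricMedian

section FirstComponents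

variable {Ω : Type*} [MeasurableSpace Ω] {P : Measure Ω} [IsProbabilityMeasure P] {M : ℕ}
  {q c σmin C : ℝ} {X : ℕ → Ω → ℝ}

lemma ClassD.integrable_firstComponents (h : ClassD P M q c σmin C X) (p : ℕ) :
    Integrable (firstComponents X p) P := by
  have hm : Measurable (firstComponents X p) := by
    unfold firstComponents
    have := h.measurable
    fun_prop
  refine (integrable_finsetSum (Finset.univ : Finset (Fin p))
    fun j _ => (h.integrable j).norm).mono' hm.aestronglyMeasurable (ae_of_all _ fun ω => ?_)
  have e : firstComponents X p ω =
      ∑ j : Fin p, EuclideanSpace.single j (firstComponents X p ω j) := by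
    ext k
    simp
  rw [e]
  refine (norm_sum_le _ _).trans_eq ?_
  simp [firstComponents]

/-- The variables `X 0` and `X (M + 1)` are independent, so the law of `(X 0, …, X (p - 1))` is not
carried by a line as soon as `M + 2 ≤ p`. -/
theorem ClassD.existsUnique_isGeometricMedian (h : ClassD P M q c σmin C X) (p : ℕ)
    (hp : M + 2 ≤ p) : ∃! v, IsGeometricMedian P (firstComponents X p) v := by
  have hint := h.integrable_firstComponents p
  obtain ⟨v, hv⟩ := exists_isGeometricMedian hint
  refine ⟨v, hv, fun w hw => ?_⟩
  by_contra hne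
  have hcol := hv.ae_collinear hint hw
  have hcoord : ∀ k : Fin p, w k ≠ v k := by
    intro k hk
    obtain ⟨l, hl⟩ : ∃ l, w l ≠ v l := by
      by_contra! hall
      exact hne (by ext l; exact hall l)
    have hfalse : ∀ᵐ _ ∂P, False := by
      filter_upwards [hcol, h.ae_ne (fun _ => v k)] with ω hω hω'
      have h1 := hω l k
      rw [hk, sub_self, zero_mul] at h1
      rcases mul_eq_zero.1 h1 with h2 | h2
      · exact hl (sub_eq_zero.1 h2)
      · exact hω' k h2
    exact hfalse.exists.elim fun _ hf => hf
  let k : Fin p := ⟨0, by omega⟩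
  let l : Fin p := ⟨M + 1, by omega⟩
  have hind : IndepFun (X 0) (X (M + 1)) P := h.mDependent.indepFun (by omega)
  have hI1 : Integrable (fun ω => centered P X 0 ω * (X (M + 1) ω - v l)) P := by
    have : IndepFun (centered P X 0) (fun ω => X (M + 1) ω - v l) P :=
      hind.comp (φ := fun x => x - ∫ ω', X 0 ω' ∂P) (ψ := fun x => x - v l)
        (by fun_prop) (by fun_prop)
    exact this.integrable_mul (h.integrable_centered 0) ((h.integrable _).sub (integrable_const _))
  have hE1 : ∫ ω, centered P X 0 ω * (X (M + 1) ω - v l) ∂P = 0 := by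
    have : IndepFun (centered P X 0) (fun ω => X (M + 1) ω - v l) P :=
      hind.comp (φ := fun x => x - ∫ ω', X 0 ω' ∂P) (ψ := fun x => x - v l)
        (by fun_prop) (by fun_prop)
    rw [this.integral_fun_mul_eq_mul_integral (h.measurable_centered 0).aestronglyMeasurable
      ((h.measurable _).sub_const _).aestronglyMeasurable, h.integral_centered, zero_mul]
  have hE2 : ∫ ω, centered P X 0 ω * (X 0 ω - v k) ∂P = variance (X 0) P := by
    have e : (fun ω => centered P X 0 ω * (X 0 ω - v k)) = fun ω =>
        centered P X 0 ω ^ 2 + centered P X 0 ω * ((∫ ω', X 0 ω' ∂P) - v k) := by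
      ext ω
      simp only [centered]
      ring
    rw [e, integral_add (h.integrable_centered_sq 0) ((h.integrable_centered 0).mul_const _),
      integral_mul_const, h.integral_centered, zero_mul, add_zero, h.variance_eq]
  have hmain : (w k - v k) * ∫ ω, centered P X 0 ω * (X (M + 1) ω - v l) ∂P =
      (w l - v l) * ∫ ω, centered P X 0 ω * (X 0 ω - v k) ∂P := by
    rw [← integral_const_mul, ← integral_const_mul]
    refine integral_congr_ae ?_
    filter_upwards [hcol] with ω hω
    have := hω k l
    simp only [firstComponents, k, l] at this ⊢
    linear_combination centered P X 0 ω * this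
  rw [hE1, hE2, mul_zero] at hmain
  have hvar := h.sq_le_variance 0
  have hσ := h.σmin_pos
  have : 0 < variance (X 0) P := lt_of_lt_of_le (by positivity) hvar
  rcases mul_eq_zero.1 hmain.symm with h0 | h0
  · exact hcoord l (sub_eq_zero.1 h0)
  · exact this.ne' h0

end FirstComponents

/-! ### A law of large numbers in `L¹` for the squares -/

section LawOfLargeNumbers

variable {Ω : Type*} [MeasurableSpace Ω] {P : Measure Ω} [IsProbabilityMeasure P] {M : ℕ}
  {q c σmin C : ℝ} {X : ℕ → Ω → ℝ}

/-- Only the at most `(2M + 1) p` pairs at distance at most `M` contribute to the variance of a sum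
of `p` bounded centred `M`-dependent variables. -/
lemma integral_abs_sum_le_of_bounded {W : ℕ → Ω → ℝ} {T : ℝ} (hT : 0 < T)
    (hm : ∀ j, Measurable (W j)) (hb : ∀ j ω, |W j ω| ≤ T) (h0 : ∀ j, ∫ ω, W j ω ∂P = 0)
    (hind : ∀ i j, i + M < j → IndepFun (W i) (W j) P) (p : ℕ) (hp : 0 < p) :
    ∫ ω, |∑ j ∈ Finset.range p, W j ω| ∂P ≤ T * √((2 * M + 1) * p) := by
  have hint : ∀ j, Integrable (W j) P := fun j =>
    (integrable_const T).mono' (hm j).aestronglyMeasurable (ae_of_all _ (hb j))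
  have hprod : ∀ i j, Integrable (fun ω => W i ω * W j ω) P := fun i j =>
    (integrable_const (T * T)).mono' ((hm i).mul (hm j)).aestronglyMeasurable
      (ae_of_all _ fun ω => by
        rw [Real.norm_eq_abs, abs_mul]
        exact mul_le_mul (hb i ω) (hb j ω) (abs_nonneg _) hT.le)
  have hcov : ∀ i j, ∫ ω, W i ω * W j ω ∂P ≤ if j ∈ exclusionSet M i then T ^ 2 else 0 := by
    intro i j
    split_ifs with hij
    · calc ∫ ω, W i ω * W j ω ∂P ≤ ∫ _, T ^ 2 ∂P := by
            refine integral_mono (hprod i j) (integrable_const _) fun ω => ?_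
            refine (le_abs_self _).trans ?_
            rw [abs_mul, sq]
            exact mul_le_mul (hb i ω) (hb j ω) (abs_nonneg _) hT.le
        _ = T ^ 2 := by simp
    · have : IndepFun (W i) (W j) P := by
        rw [exclusionSet, Finset.mem_Icc] at hij
        rcases le_or_gt j (i + M) with h | h
        · exact (hind j i (by omega)).symm
        · exact hind i j h
      rw [this.integral_fun_mul_eq_mul_integral (hm i).aestronglyMeasurable
        (hm j).aestronglyMeasurable, h0, zero_mul]
  have hsq : ∫ ω, (∑ j ∈ Finset.range p, W j ω) ^ 2 ∂P ≤ (2 * M + 1) * p * T ^ 2 := by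
    calc ∫ ω, (∑ j ∈ Finset.range p, W j ω) ^ 2 ∂P
        = ∑ i ∈ Finset.range p, ∑ j ∈ Finset.range p, ∫ ω, W i ω * W j ω ∂P := by
          simp_rw [sq, Finset.sum_mul_sum]
          rw [integral_finsetSum _ fun i _ => integrable_finsetSum _ fun j _ => hprod i j]
          exact Finset.sum_congr rfl fun i _ => integral_finsetSum _ fun j _ => hprod i j
      _ ≤ ∑ i ∈ Finset.range p, ∑ j ∈ Finset.range p,
            if j ∈ exclusionSet M i then T ^ 2 else 0 := by
          gcongr with i _ j _
          exact hcov i j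
      _ ≤ ∑ i ∈ Finset.range p, (2 * M + 1) * T ^ 2 := by
          gcongr with i _
          rw [← Finset.sum_filter, Finset.sum_const, nsmul_eq_mul]
          gcongr
          have : (Finset.filter (fun j => j ∈ exclusionSet M i) (Finset.range p)).card ≤
              2 * M + 1 := by
            refine (Finset.card_le_card (t := exclusionSet M i) fun j hj =>
              (Finset.mem_filter.1 hj).2).trans ?_
            rw [exclusionSet, Nat.card_Icc]
            omega
          exact_mod_cast this
      _ = (2 * M + 1) * p * T ^ 2 := by
          rw [Finset.sum_const, Finset.card_range, nsmul_eq_mul]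
          ring
  have hp' : (0 : ℝ) < p := by exact_mod_cast hp
  set t := T * √((2 * M + 1) * p) with ht
  have htpos : 0 < t := by positivity
  have ht2 : t ^ 2 = (2 * M + 1) * p * T ^ 2 := by
    rw [ht, mul_pow, Real.sq_sqrt (by positivity)]
    ring
  have hsqint : Integrable (fun ω => (∑ j ∈ Finset.range p, W j ω) ^ 2) P := by
    simp_rw [sq, Finset.sum_mul_sum]
    exact integrable_finsetSum _ fun i _ => integrable_finsetSum _ fun j _ => hprod i j
  -- `|S| ≤ (S² / t + t) / 2` with `t` the claimed bound replaces the Cauchy–Schwarz inequality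
  calc ∫ ω, |∑ j ∈ Finset.range p, W j ω| ∂P
      ≤ ∫ ω, ((∑ j ∈ Finset.range p, W j ω) ^ 2 / (2 * t) + t / 2) ∂P := by
        refine integral_mono (integrable_finsetSum _ fun j _ => hint j).abs
          ((hsqint.div_const _).add (integrable_const _)) fun ω => ?_
        simp only
        rw [← sq_abs, div_add_div _ _ (by positivity) (by positivity), le_div_iff₀ (by positivity)]
        nlinarith [sq_nonneg (|∑ j ∈ Finset.range p, W j ω| - t)]
    _ = (∫ ω, (∑ j ∈ Finset.range p, W j ω) ^ 2 ∂P) / (2 * t) + t / 2 := by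
        rw [integral_add (hsqint.div_const _) (integrable_const _), integral_div]
        simp
    _ ≤ t ^ 2 / (2 * t) + t / 2 := by
        gcongr
        rw [ht2]
        exact hsq
    _ = t := by
        field_simp
        ring

lemma sq_sub_min_le {q T : ℝ} (hq : 3 ≤ q) (hT : 1 ≤ T) (y : ℝ) :
    |y ^ 2 - min (y ^ 2) T| ≤ |y| ^ q / √T := by
  have hT0 : 0 < √T := Real.sqrt_pos.2 (by linarith)
  have hq0 : 0 ≤ |y| ^ q := Real.rpow_nonneg (abs_nonneg y) q
  rcases le_total (y ^ 2) T with h | h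
  · rw [min_eq_left h, sub_self, abs_zero]
    positivity
  · rw [min_eq_right h, abs_of_nonneg (sub_nonneg.2 h), le_div_iff₀ hT0]
    have hy : √T ≤ |y| := by
      rw [← Real.sqrt_sq_eq_abs]
      exact Real.sqrt_le_sqrt h
    have hy1 : 1 ≤ |y| := (Real.one_le_sqrt.2 hT).trans hy
    calc (y ^ 2 - T) * √T ≤ y ^ 2 * |y| := by
          have : y ^ 2 - T ≤ y ^ 2 := by linarith
          exact mul_le_mul this hy hT0.le (sq_nonneg y)
      _ = |y| ^ (3 : ℝ) := by
          rw [← sq_abs, show (3 : ℝ) = ((3 : ℕ) : ℝ) by norm_num, Real.rpow_natCast]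
          ring
      _ ≤ |y| ^ q := Real.rpow_le_rpow_of_exponent_le hy1 hq

/-- Truncating the squares at level `T` costs `2C / √T` per variable; the truncated variables are
bounded by `T`. -/
lemma ClassD.integral_abs_sum_sq_sub_le (h : ClassD P M q c σmin C X) (hq : 3 ≤ q) {T : ℝ}
    (hT : 1 ≤ T) (p : ℕ) (hp : 0 < p) :
    ∫ ω, |∑ j ∈ Finset.range p, (centered P X j ω ^ 2 - variance (X j) P)| ∂P ≤
      p * (2 * C / √T) + T * √((2 * M + 1) * p) := by
  set φ : ℝ → ℝ := fun x => min (x ^ 2) T with hφ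
  have hφm : Measurable φ := by fun_prop
  have hφb : ∀ x, |φ x| ≤ T := fun x => by
    rw [abs_of_nonneg (le_min (sq_nonneg x) (by linarith))]
    exact min_le_right _ _
  have hφ0 : ∀ x, 0 ≤ φ x := fun x => le_min (sq_nonneg x) (by linarith)
  set U : ℕ → Ω → ℝ := fun j ω => φ (centered P X j ω) with hU
  have hUm : ∀ j, Measurable (U j) := fun j => hφm.comp (h.measurable_centered j)
  have hUi : ∀ j, Integrable (U j) P := fun j =>
    (integrable_const T).mono' (hUm j).aestronglyMeasurable (ae_of_all _ fun ω => hφb _)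
  set W : ℕ → Ω → ℝ := fun j ω => U j ω - ∫ ω', U j ω' ∂P with hW
  have hWi : ∀ j, Integrable (W j) P := fun j => (hUi j).sub (integrable_const _)
  have hEU : ∀ j, ∫ ω, U j ω ∂P ∈ Set.Icc 0 T := fun j => by
    refine ⟨integral_nonneg fun ω => hφ0 _, ?_⟩
    calc ∫ ω, U j ω ∂P ≤ ∫ _, T ∂P :=
          integral_mono (hUi j) (integrable_const _) fun ω => min_le_right _ _
      _ = T := by simp
  have hbd := integral_abs_sum_le_of_bounded (P := P) (M := M) (W := W) (T := T) (by linarith)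
    (fun j => (hUm j).sub_const _)
    (fun j ω => abs_sub_le_iff.2 ⟨by
      have := (hEU j).1
      have h2 : U j ω ≤ T := min_le_right _ _
      linarith, by
      have := (hEU j).2
      have h2 : 0 ≤ U j ω := hφ0 _
      linarith⟩)
    (fun j => by
      simp only [hW]
      rw [integral_sub (hUi j) (integrable_const _)]
      simp)
    (fun i j hij => (h.mDependent.indepFun hij).comp
      (φ := fun x => φ (x - ∫ ω', X i ω' ∂P) - ∫ ω', U i ω' ∂P)
      (ψ := fun x => φ (x - ∫ ω', X j ω' ∂P) - ∫ ω', U j ω' ∂P)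
      (by fun_prop) (by fun_prop)) p hp
  have hdi : ∀ j, Integrable (fun ω => centered P X j ω ^ 2 - U j ω) P := fun j =>
    (h.integrable_centered_sq j).sub (hUi j)
  have hd : ∀ j, ∫ ω, |centered P X j ω ^ 2 - U j ω| ∂P ≤ C / √T := fun j => by
    calc ∫ ω, |centered P X j ω ^ 2 - U j ω| ∂P ≤ ∫ ω, |centered P X j ω| ^ q / √T ∂P :=
          integral_mono (hdi j).abs ((h.integrable_abs_rpow_centered j).div_const _)
            fun ω => sq_sub_min_le hq hT _
      _ ≤ C / √T := by
          rw [integral_div]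
          gcongr
          exact h.integral_abs_rpow_centered_le j
  have hdc : ∀ j, Integrable (fun ω => |centered P X j ω ^ 2 - U j ω| + C / √T) P := fun j =>
    (hdi j).abs.add (integrable_const _)
  have hd' : ∀ j, |variance (X j) P - ∫ ω, U j ω ∂P| ≤ C / √T := fun j => by
    rw [h.variance_eq, ← integral_sub (h.integrable_centered_sq j) (hUi j)]
    exact abs_integral_le_integral_abs.trans (hd j)
  calc ∫ ω, |∑ j ∈ Finset.range p, (centered P X j ω ^ 2 - variance (X j) P)| ∂P
      ≤ ∫ ω, (∑ j ∈ Finset.range p, (|centered P X j ω ^ 2 - U j ω| + C / √T) +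
          |∑ j ∈ Finset.range p, W j ω|) ∂P := by
        refine integral_mono (integrable_finsetSum _ fun j _ =>
          (h.integrable_centered_sq j).sub (integrable_const _)).abs
          ((integrable_finsetSum _ fun j _ => hdc j).add
            (integrable_finsetSum _ fun j _ => hWi j).abs) fun ω => ?_
        have e : ∑ j ∈ Finset.range p, (centered P X j ω ^ 2 - variance (X j) P) =
            ∑ j ∈ Finset.range p, ((centered P X j ω ^ 2 - U j ω) -
              (variance (X j) P - ∫ ω', U j ω' ∂P)) + ∑ j ∈ Finset.range p, W j ω := by
          rw [← Finset.sum_add_distrib]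
          exact Finset.sum_congr rfl fun j _ => by simp only [hW]; ring
        simp only
        rw [e]
        refine (abs_add_le _ _).trans ?_
        gcongr
        refine (Finset.abs_sum_le_sum_abs _ _).trans ?_
        gcongr with j _
        refine (abs_sub _ _).trans ?_
        gcongr
        exact hd' j
    _ = ∑ j ∈ Finset.range p, (∫ ω, |centered P X j ω ^ 2 - U j ω| ∂P + C / √T) +
          ∫ ω, |∑ j ∈ Finset.range p, W j ω| ∂P := by
        rw [integral_add (integrable_finsetSum _ fun j _ => hdc j)
          (integrable_finsetSum _ fun j _ => hWi j).abs, integral_finsetSum _ fun j _ => hdc j]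
        congr 1
        refine Finset.sum_congr rfl fun j _ => ?_
        rw [integral_add (hdi j).abs (integrable_const _)]
        simp
    _ ≤ ∑ j ∈ Finset.range p, (C / √T + C / √T) + T * √((2 * M + 1) * p) := by
        gcongr with j _
        exact hd j
    _ = p * (2 * C / √T) + T * √((2 * M + 1) * p) := by
        rw [Finset.sum_const, Finset.card_range, nsmul_eq_mul]
        ring

theorem ClassD.tendsto_integral_abs_sum_sq_sub (h : ClassD P M q c σmin C X) (hq : 3 ≤ q) :
    Tendsto (fun p : ℕ =>
      (∫ ω, |∑ j ∈ Finset.range p, (centered P X j ω ^ 2 - variance (X j) P)| ∂P) / p)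
      atTop (𝓝 0) := by
  have hr : Tendsto (fun p : ℕ => √(√(√(p : ℝ)))) atTop atTop :=
    Real.tendsto_sqrt_atTop.comp (Real.tendsto_sqrt_atTop.comp
      (Real.tendsto_sqrt_atTop.comp tendsto_natCast_atTop_atTop))
  have hlim : Tendsto (fun p : ℕ => 2 * C / √(√(√(p : ℝ))) +
      √(2 * M + 1) / (√(√(√(p : ℝ)))) ^ 2) atTop (𝓝 0) := by
    have h1 := hr.const_div_atTop (2 * C)
    have h2 := ((tendsto_pow_atTop two_ne_zero).comp hr).const_div_atTop (√(2 * (M : ℝ) + 1))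
    simpa using h1.add h2
  refine squeeze_zero' (Eventually.of_forall fun p => by positivity) ?_ hlim
  filter_upwards [eventually_ge_atTop 1] with p hp
  have hp' : (1 : ℝ) ≤ p := by exact_mod_cast hp
  -- the truncation level `√√p` balances the two error terms
  have hT : 1 ≤ √(√(p : ℝ)) := Real.one_le_sqrt.2 (Real.one_le_sqrt.2 hp')
  have key := h.integral_abs_sum_sq_sub_le hq hT p hp
  have hp0 : (0 : ℝ) < p := by linarith
  rw [div_le_iff₀ hp0]
  refine key.trans_eq ?_
  rw [Real.sqrt_mul (by positivity)]
  set r := √(√(√(p : ℝ))) with hrdef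
  have hr0 : 0 < r := by positivity
  have e1 : √(√(p : ℝ)) = r ^ 2 := (Real.sq_sqrt (Real.sqrt_nonneg _)).symm
  have e2 : √(p : ℝ) = r ^ 4 := by
    rw [show r ^ 4 = (r ^ 2) ^ 2 by ring, ← e1, Real.sq_sqrt (Real.sqrt_nonneg _)]
  have e3 : (p : ℝ) = r ^ 8 := by
    rw [show r ^ 8 = (r ^ 4) ^ 2 by ring, ← e2, Real.sq_sqrt hp0.le]
  rw [e1, e2, e3]
  field_simp

end LawOfLargeNumbers

/-! ### Convergence of integrals of products -/

section Convergence

/-- Young's inequality with a small factor: since `1 / s + 1 / k < 1`, the product `x y` is of lower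
order than `x ^ s + y ^ k`. -/
lemma exists_mul_le_mul_rpow_add_pow {s : ℝ} {k : ℕ} (hs : 0 < s) (hk : 0 < k)
    (hsk : 1 / s + 1 / (k : ℝ) < 1) {η : ℝ} (hη : 0 < η) :
    ∃ K : ℝ, 0 ≤ K ∧ ∀ x y : ℝ, 0 ≤ x → 0 ≤ y → x * y ≤ η * (x ^ s + y ^ k) + K := by
  set θ := 1 / s + 1 / (k : ℝ) with hθ
  have hk' : (0 : ℝ) < k := by exact_mod_cast hk
  have hθ0 : 0 < θ := by positivity
  have hlim := tendsto_rpow_neg_atTop (y := 1 - θ) (by linarith)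
  obtain ⟨T, hT⟩ := eventually_atTop.1 (hlim.eventually (gt_mem_nhds hη))
  set T' := max T 1 with hT'
  have hT'0 : 0 < T' := lt_of_lt_of_le one_pos (le_max_right _ _)
  refine ⟨T' ^ θ, by positivity, fun x y hx hy => ?_⟩
  set z := x ^ s + y ^ k with hz
  have hxs : 0 ≤ x ^ s := Real.rpow_nonneg hx s
  have hyk : 0 ≤ y ^ k := pow_nonneg hy k
  have hz0 : 0 ≤ z := by positivity
  have h1 : x ≤ z ^ (1 / s) := by
    calc x = (x ^ s) ^ (1 / s) := by rw [← Real.rpow_mul hx, mul_one_div_cancel hs.ne',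
          Real.rpow_one]
      _ ≤ z ^ (1 / s) := Real.rpow_le_rpow hxs (by linarith) (by positivity)
  have h2 : y ≤ z ^ (1 / (k : ℝ)) := by
    calc y = (y ^ k) ^ (1 / (k : ℝ)) := by
          rw [← Real.rpow_natCast, ← Real.rpow_mul hy, mul_one_div_cancel hk'.ne', Real.rpow_one]
      _ ≤ z ^ (1 / (k : ℝ)) := Real.rpow_le_rpow hyk (by linarith) (by positivity)
  have h3 : x * y ≤ z ^ θ := by
    rw [hθ, Real.rpow_add' hz0 hθ0.ne']
    exact mul_le_mul h1 h2 hy (Real.rpow_nonneg hz0 _)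
  rcases le_total z T' with h | h
  · have : z ^ θ ≤ T' ^ θ := Real.rpow_le_rpow hz0 h hθ0.le
    have : 0 ≤ η * z := by positivity
    linarith
  · have hzpos : 0 < z := hT'0.trans_le h
    have h4 := hT z ((le_max_left _ _).trans h)
    have h5 : z ^ θ = z ^ (-(1 - θ)) * z := by
      conv_rhs => rw [← Real.rpow_one z, ← Real.rpow_mul hz0, one_mul, ← Real.rpow_add hzpos]
      congr 1
      ring
    have h6 : z ^ (-(1 - θ)) * z ≤ η * z := mul_le_mul_of_nonneg_right h4.le hz0
    have : 0 < T' ^ θ := by positivity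
    linarith

variable {Ω : Type*} [MeasurableSpace Ω] {P : Measure Ω} [IsProbabilityMeasure P]

/-- If `H p → 0` in probability with bounded `k`-th moments, and the `V p` are dominated by a fixed
function of class `L^s` with `1 / s + 1 / k < 1`, then `E[V p H p] → 0`. -/
lemma tendsto_integral_mul_zero {s : ℝ} {k : ℕ} (hs : 0 < s) (hk : 0 < k)
    (hsk : 1 / s + 1 / (k : ℝ) < 1) {V H : ℕ → Ω → ℝ} {V₀ : Ω → ℝ} {B : ℝ}
    (hV₀ : Integrable V₀ P) (hV₀s : Integrable (fun ω => V₀ ω ^ s) P)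
    (hV : ∀ᶠ p in atTop, ∀ ω, |V p ω| ≤ V₀ ω) (hHm : ∀ p, Measurable (H p))
    (hHi : ∀ᶠ p in atTop, Integrable (fun ω => |H p ω| ^ k) P ∧ ∫ ω, |H p ω| ^ k ∂P ≤ B)
    (hH : ∀ ε > 0, Tendsto (fun p => P.real {ω | ε ≤ |H p ω|}) atTop (𝓝 0)) :
    Tendsto (fun p => ∫ ω, V p ω * H p ω ∂P) atTop (𝓝 0) := by
  have hV₀nn : ∀ ω, 0 ≤ V₀ ω := by
    obtain ⟨p, hp⟩ := hV.exists
    exact fun ω => (abs_nonneg _).trans (hp ω)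
  have hB : 0 ≤ B := by
    obtain ⟨p, hp⟩ := hHi.exists
    exact (integral_nonneg fun ω => by positivity).trans hp.2
  set D := ∫ ω, V₀ ω ^ s ∂P with hD
  have hD0 : 0 ≤ D := integral_nonneg fun ω => Real.rpow_nonneg (hV₀nn ω) s
  have hE0 : 0 ≤ ∫ ω, V₀ ω ∂P := integral_nonneg hV₀nn
  rw [tendsto_zero_iff_norm_tendsto_zero, Metric.tendsto_nhds]
  intro δ hδ
  set ε := δ / (4 * (∫ ω, V₀ ω ∂P + 1)) with hε
  set η := δ / (4 * (D + B + 1)) with hη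
  have hε0 : 0 < ε := by positivity
  have hη0 : 0 < η := by positivity
  obtain ⟨K, hK0, hK⟩ := exists_mul_le_mul_rpow_add_pow hs hk hsk hη0
  have hlim : Tendsto (fun p => K * P.real {ω | ε ≤ |H p ω|}) atTop (𝓝 0) := by
    simpa using (hH ε hε0).const_mul K
  filter_upwards [hV, hHi, hlim.eventually (gt_mem_nhds (show 0 < δ / 4 by positivity))]
    with p hVp hHp hKp
  have hS : MeasurableSet {ω | ε ≤ |H p ω|} := measurableSet_le measurable_const (hHm p).abs
  have hind : Integrable ({ω | ε ≤ |H p ω|}.indicator fun _ => K) P :=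
    (integrable_const K).indicator hS
  have hdom : Integrable (fun ω => ε * V₀ ω + η * (V₀ ω ^ s + |H p ω| ^ k) +
      {ω | ε ≤ |H p ω|}.indicator (fun _ => K) ω) P :=
    ((hV₀.const_mul ε).add ((hV₀s.add hHp.1).const_mul η)).add hind
  have hle := norm_integral_le_of_norm_le (f := fun ω => V p ω * H p ω) hdom
    (ae_of_all _ fun ω => by
      rw [Real.norm_eq_abs, abs_mul]
      have hr : 0 ≤ V₀ ω ^ s := Real.rpow_nonneg (hV₀nn ω) s
      have hm : |V p ω| * |H p ω| ≤ V₀ ω * |H p ω| :=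
        mul_le_mul_of_nonneg_right (hVp ω) (abs_nonneg _)
      by_cases hω : ε ≤ |H p ω|
      · rw [Set.indicator_of_mem (by exact hω)]
        have := hK (V₀ ω) |H p ω| (hV₀nn ω) (abs_nonneg _)
        have : 0 ≤ ε * V₀ ω := mul_nonneg hε0.le (hV₀nn ω)
        linarith
      · rw [Set.indicator_of_notMem (by exact hω)]
        have h1 : V₀ ω * |H p ω| ≤ V₀ ω * ε :=
          mul_le_mul_of_nonneg_left (not_le.1 hω).le (hV₀nn ω)
        have h2 : 0 ≤ η * (V₀ ω ^ s + |H p ω| ^ k) := by positivity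
        linarith)
  have heq : ∫ ω, (ε * V₀ ω + η * (V₀ ω ^ s + |H p ω| ^ k) +
      {ω | ε ≤ |H p ω|}.indicator (fun _ => K) ω) ∂P =
      ε * ∫ ω, V₀ ω ∂P + η * (D + ∫ ω, |H p ω| ^ k ∂P) + K * P.real {ω | ε ≤ |H p ω|} := by
    have i1 : Integrable (fun ω => ε * V₀ ω) P := hV₀.const_mul ε
    have i2 : Integrable (fun ω => η * (V₀ ω ^ s + |H p ω| ^ k)) P :=
      (hV₀s.add hHp.1).const_mul η
    have i3 : Integrable (fun ω => ε * V₀ ω + η * (V₀ ω ^ s + |H p ω| ^ k)) P := i1.add i2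
    rw [integral_add i3 hind, integral_add i1 i2, integral_const_mul, integral_const_mul,
      integral_add hV₀s hHp.1, integral_indicator_const _ hS, smul_eq_mul, mul_comm K]
  rw [heq] at hle
  have b1 : ε * ∫ ω, V₀ ω ∂P ≤ δ / 4 := by
    calc ε * ∫ ω, V₀ ω ∂P ≤ ε * (∫ ω, V₀ ω ∂P + 1) := by gcongr; linarith
      _ = δ / 4 := by rw [hε]; field_simp
  have b2 : η * (D + ∫ ω, |H p ω| ^ k ∂P) ≤ δ / 4 := by
    calc η * (D + ∫ ω, |H p ω| ^ k ∂P) ≤ η * (D + B + 1) :=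
          mul_le_mul_of_nonneg_left (by linarith [hHp.2]) hη0.le
      _ = δ / 4 := by rw [hη]; field_simp
  rw [dist_zero_right, norm_norm]
  linarith

/-- Continuous images of sequences converging in `L¹` to a constant converge in probability. -/
lemma tendsto_measureReal_le_abs_comp_sub {g : ℝ × ℝ → ℝ} {τ : ℝ} (hg : ContinuousAt g (τ, τ))
    {x y : ℕ → Ω → ℝ} (hxi : ∀ p, Integrable (x p) P) (hyi : ∀ p, Integrable (y p) P)
    (hx : Tendsto (fun p => ∫ ω, |x p ω - τ| ∂P) atTop (𝓝 0))
    (hy : Tendsto (fun p => ∫ ω, |y p ω - τ| ∂P) atTop (𝓝 0)) {ε : ℝ} (hε : 0 < ε) :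
    Tendsto (fun p => P.real {ω | ε ≤ |g (x p ω, y p ω) - g (τ, τ)|}) atTop (𝓝 0) := by
  obtain ⟨δ, hδ, hgδ⟩ := Metric.continuousAt_iff.1 hg ε hε
  have hlim : Tendsto (fun p => (∫ ω, |x p ω - τ| ∂P) / δ + (∫ ω, |y p ω - τ| ∂P) / δ)
      atTop (𝓝 0) := by
    simpa using (hx.div_const δ).add (hy.div_const δ)
  have hmarkov : ∀ z : Ω → ℝ, Integrable z P →
      P.real {ω | δ ≤ |z ω - τ|} ≤ (∫ ω, |z ω - τ| ∂P) / δ := by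
    intro z hz
    rw [le_div_iff₀ hδ, mul_comm]
    exact mul_meas_ge_le_integral_of_nonneg (ae_of_all _ fun ω => abs_nonneg _)
      (hz.sub (integrable_const τ)).abs δ
  refine squeeze_zero (fun p => measureReal_nonneg) (fun p => ?_) hlim
  calc P.real {ω | ε ≤ |g (x p ω, y p ω) - g (τ, τ)|}
      ≤ P.real ({ω | δ ≤ |x p ω - τ|} ∪ {ω | δ ≤ |y p ω - τ|}) := by
        refine measureReal_mono fun ω hω => ?_
        by_contra hcon
        simp only [Set.mem_union, Set.mem_ofPred_eq, not_or, not_le] at hcon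
        have := hgδ (x := (x p ω, y p ω)) (by
          rw [Prod.dist_eq]
          exact max_lt hcon.1 hcon.2)
        exact absurd hω (not_le.2 this)
    _ ≤ P.real {ω | δ ≤ |x p ω - τ|} + P.real {ω | δ ≤ |y p ω - τ|} := measureReal_union_le _ _
    _ ≤ _ := add_le_add (hmarkov _ (hxi p)) (hmarkov _ (hyi p))

end Convergence

/-! ### Difference quotients of the inverse square root -/

section InvSqrtSlope

lemma sqrt_div_eq_one_div_sqrt (p N : ℝ) : √(p / N) = 1 / √(N / p) := by
  rw [← one_div_div, Real.sqrt_div zero_le_one, Real.sqrt_one]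

/-- The divided difference `(1 / √x - 1 / √y) / (y - x)` of `-1 / √·`, in a form that makes sense
on the diagonal. -/
noncomputable def invSqrtSlope (x y : ℝ) : ℝ := 1 / (√x * √y * (√x + √y))

lemma invSqrtSlope_nonneg (x y : ℝ) : 0 ≤ invSqrtSlope x y := by
  unfold invSqrtSlope
  positivity

lemma inv_sqrt_sub_inv_sqrt {x y : ℝ} (hx : 0 < x) (hy : 0 < y) :
    1 / √x - 1 / √y = (y - x) * invSqrtSlope x y := by
  have h1 : 0 < √x := Real.sqrt_pos.2 hx
  have h2 : 0 < √y := Real.sqrt_pos.2 hy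
  have e : y - x = (√y - √x) * (√x + √y) := by
    nlinarith [Real.sq_sqrt hx.le, Real.sq_sqrt hy.le]
  rw [e, invSqrtSlope]
  field_simp

lemma invSqrtSlope_sq_le {x y : ℝ} (hx : 0 < x) (hxy : x ≤ y) :
    invSqrtSlope x y ^ 2 ≤ (1 / x) ^ 3 := by
  have h1 : 0 < √x := Real.sqrt_pos.2 hx
  have h2 : √x ≤ √y := Real.sqrt_le_sqrt hxy
  have h3 : invSqrtSlope x y ≤ 1 / (√x * √x * √x) := by
    unfold invSqrtSlope
    refine one_div_le_one_div_of_le (by positivity) ?_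
    gcongr
    linarith
  calc invSqrtSlope x y ^ 2 ≤ (1 / (√x * √x * √x)) ^ 2 :=
        pow_le_pow_left₀ (invSqrtSlope_nonneg x y) h3 2
    _ = (1 / x) ^ 3 := by
        rw [div_pow, div_pow, one_pow, one_pow, show (√x * √x * √x) ^ 2 = (√x ^ 2) ^ 3 by ring,
          Real.sq_sqrt hx.le]

lemma continuousAt_invSqrtSlope {τ : ℝ} (hτ : 0 < τ) :
    ContinuousAt (fun z : ℝ × ℝ => invSqrtSlope z.1 z.2) (τ, τ) := by
  have h1 : 0 < √τ := Real.sqrt_pos.2 hτ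
  unfold invSqrtSlope
  refine ContinuousAt.div continuousAt_const ?_ (by positivity)
  fun_prop

lemma invSqrtSlope_self {τ : ℝ} (hτ : 0 < τ) : invSqrtSlope τ τ = 1 / √τ * (1 / (2 * τ)) := by
  have h1 : 0 < √τ := Real.sqrt_pos.2 hτ
  rw [invSqrtSlope, Real.mul_self_sqrt hτ.le]
  field_simp
  ring

lemma measurable_invSqrtSlope : Measurable (fun z : ℝ × ℝ => invSqrtSlope z.1 z.2) := by
  unfold invSqrtSlope
  fun_prop

end InvSqrtSlope

/-! ### Uniform bounds for the coordinates of the median -/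

section MedianCenter

variable {Ω : Type*} [MeasurableSpace Ω] {P : Measure Ω} {M : ℕ} {q c σmin C : ℝ}
  {X : ℕ → Ω → ℝ}

/-- The sequence `w` minimizes the expected distance to `(X 0, …, X (p - 1))` and satisfies the
first-order conditions. Coordinates are indexed by `ℕ`, and those from `p` on play no role. -/
structure IsMedianCenter (P : Measure Ω) (X : ℕ → Ω → ℝ) (p : ℕ) (w : ℕ → ℝ) : Prop where
  le : ∀ u : ℕ → ℝ, ∫ ω, √(sqDist X w (Finset.range p) ω) ∂P ≤
    ∫ ω, √(sqDist X u (Finset.range p) ω) ∂P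
  integral_eq_zero : ∀ i < p, ∫ ω, (X i ω - w i) / √(sqDist X w (Finset.range p) ω) ∂P = 0

omit [MeasurableSpace Ω] in
lemma norm_firstComponents_sub {p : ℕ} (v : EuclideanSpace ℝ (Fin p)) (w : ℕ → ℝ)
    (hw : ∀ j : Fin p, w j = v j) (ω : Ω) :
    ‖firstComponents X p ω - v‖ = √(sqDist X w (Finset.range p) ω) := by
  rw [EuclideanSpace.norm_eq, sqDist, Finset.sum_range]
  simp [firstComponents, hw]

lemma IsGeometricMedian.isMedianCenter [IsProbabilityMeasure P] (h : ClassD P M q c σmin C X)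
    {p : ℕ} {v : EuclideanSpace ℝ (Fin p)}
    (hv : IsGeometricMedian P (firstComponents X p) v) {w : ℕ → ℝ}
    (hw : ∀ j : Fin p, w j = v j) : IsMedianCenter P X p w where
  le u := by
    have := hv (WithLp.toLp 2 fun j : Fin p => u j)
    simp_rw [norm_firstComponents_sub v w hw] at this
    simp_rw [norm_firstComponents_sub (WithLp.toLp 2 fun j : Fin p => u j) u (fun _ => rfl)] at this
    exact this
  integral_eq_zero i hi := by
    have hne : ∀ᵐ ω ∂P, firstComponents X p ω ≠ v := by
      filter_upwards [h.ae_ne w] with ω hω heq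
      refine hω i ?_
      rw [hw ⟨i, hi⟩, ← heq]
      simp [firstComponents]
    have := hv.integral_div_norm_eq_zero (h.integrable_firstComponents p) hne ⟨i, hi⟩
    simp_rw [norm_firstComponents_sub v w hw, ← hw] at this
    exact this

lemma integrable_sqrt [IsFiniteMeasure P] {f : Ω → ℝ} (hf : Integrable f P) (h0 : ∀ ω, 0 ≤ f ω) :
    Integrable (fun ω => √(f ω)) P := by
  refine ((integrable_const 1).add hf).mono'
    (Real.continuous_sqrt.comp_aestronglyMeasurable hf.aestronglyMeasurable)
    (ae_of_all _ fun ω => ?_)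
  rw [Real.norm_of_nonneg (Real.sqrt_nonneg _), Pi.add_apply]
  nlinarith [Real.sq_sqrt (h0 ω), sq_nonneg (√(f ω) - 1)]

/-- The exponent `2m` used for the moments of `invSqrtSlope` is such that
`3 / q + 1 / (2m) < 1`. -/
lemma exists_slope_exponent {q : ℝ} (hq : 3 < q) :
    ∃ m : ℕ, 0 < m ∧ 1 / (q / 3) + 1 / ((2 * m : ℕ) : ℝ) < 1 := by
  have h1 : 0 < 1 - 1 / (q / 3) := by
    rw [sub_pos, div_lt_one (by linarith)]
    linarith
  obtain ⟨n, hn⟩ := exists_nat_one_div_lt h1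
  refine ⟨n + 1, Nat.succ_pos n, ?_⟩
  have : 1 / ((2 * (n + 1) : ℕ) : ℝ) ≤ 1 / ((n : ℝ) + 1) := by
    refine one_div_le_one_div_of_le (by positivity) ?_
    push_cast
    nlinarith [(Nat.cast_nonneg n : (0 : ℝ) ≤ n)]
  linarith

lemma add_add_rpow_le {q a b d : ℝ} (hq : 0 ≤ q) (ha : 0 ≤ a) (hb : 0 ≤ b) (hd : 0 ≤ d) :
    (a + b + d) ^ q ≤ 3 ^ q * (a ^ q + b ^ q + d ^ q) := by
  set m := max a (max b d) with hm
  have h1 : a ≤ m := le_max_left _ _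
  have h2 : b ≤ m := (le_max_left _ _).trans (le_max_right _ _)
  have h3 : d ≤ m := (le_max_right _ _).trans (le_max_right _ _)
  have ha' := Real.rpow_nonneg ha q
  have hb' := Real.rpow_nonneg hb q
  have hd' := Real.rpow_nonneg hd q
  have hmq : m ^ q ≤ a ^ q + b ^ q + d ^ q := by
    rcases max_choice a (max b d) with e | e
    · rw [hm, e]; linarith
    · rcases max_choice b d with e' | e' <;> · rw [hm, e, e']; linarith
  calc (a + b + d) ^ q ≤ (3 * m) ^ q := Real.rpow_le_rpow (by positivity) (by linarith) hq
    _ = 3 ^ q * m ^ q := Real.mul_rpow (by norm_num) (ha.trans h1)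
    _ ≤ _ := by gcongr

namespace ClassD

variable [IsProbabilityMeasure P]

lemma integrable_sub_sq (h : ClassD P M q c σmin C X) (j : ℕ) (r : ℝ) :
    Integrable (fun ω => (X j ω - r) ^ 2) P := by
  have e : (fun ω => (X j ω - r) ^ 2) = fun ω => centered P X j ω ^ 2 +
      (2 * ((∫ ω', X j ω' ∂P) - r) * centered P X j ω + ((∫ ω', X j ω' ∂P) - r) ^ 2) := by
    ext ω
    simp only [centered]
    ring
  rw [e]
  exact (h.integrable_centered_sq j).add
    (((h.integrable_centered j).const_mul _).add (integrable_const _))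

lemma integrable_sqDist (h : ClassD P M q c σmin C X) (w : ℕ → ℝ) (s : Finset ℕ) :
    Integrable (sqDist X w s) P :=
  integrable_finsetSum _ fun j _ => h.integrable_sub_sq j (w j)

omit [IsProbabilityMeasure P] in
lemma C_pos (h : ClassD P M q c σmin C X) : 0 < C := lt_of_lt_of_le one_pos h.one_le_C

lemma integral_sqrt_sqDist_mean_le (h : ClassD P M q c σmin C X) {p : ℕ} (hp : 0 < p) :
    ∫ ω, √(sqDist X (fun j => ∫ ω', X j ω' ∂P) (Finset.range p) ω) ∂P ≤ √(p * (1 + C)) := by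
  have hC := h.C_pos
  have hp' : (0 : ℝ) < p := by exact_mod_cast hp
  set t := √(p * (1 + C)) with ht
  have ht0 : 0 < t := by positivity
  have ht2 : t ^ 2 = p * (1 + C) := Real.sq_sqrt (by positivity)
  set μ : ℕ → ℝ := fun j => ∫ ω', X j ω' ∂P
  have hN : ∫ ω, sqDist X μ (Finset.range p) ω ∂P ≤ t ^ 2 := by
    rw [ht2]
    simp only [sqDist]
    rw [integral_finsetSum _ fun j _ => h.integrable_sub_sq j (μ j)]
    refine (Finset.sum_le_sum fun j _ => h.integral_centered_sq_le j).trans_eq ?_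
    rw [Finset.sum_const, Finset.card_range, nsmul_eq_mul]
  calc ∫ ω, √(sqDist X μ (Finset.range p) ω) ∂P
      ≤ ∫ ω, (sqDist X μ (Finset.range p) ω / (2 * t) + t / 2) ∂P := by
        refine integral_mono (integrable_sqrt (h.integrable_sqDist _ _) (sqDist_nonneg _ _))
          (((h.integrable_sqDist _ _).div_const _).add (integrable_const _)) fun ω => ?_
        simp only
        rw [div_add_div _ _ (by positivity) (by positivity), le_div_iff₀ (by positivity)]
        nlinarith [sq_nonneg (√(sqDist X μ (Finset.range p) ω) - t),
          Real.sq_sqrt (sqDist_nonneg (X := X) μ (Finset.range p) ω)]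
    _ = (∫ ω, sqDist X μ (Finset.range p) ω ∂P) / (2 * t) + t / 2 := by
        rw [integral_add ((h.integrable_sqDist _ _).div_const _) (integrable_const _),
          integral_div]
        simp
    _ ≤ t ^ 2 / (2 * t) + t / 2 := by gcongr
    _ = t := by
        field_simp
        ring

/-- Jensen's inequality `E[1 / √N] ≥ 1 / E √N`, combined with the minimality of `E √N`. -/
lemma one_div_sqrt_le_integral (h : ClassD P M q c σmin C X) {p : ℕ} (hp : 0 < p) {w : ℕ → ℝ}
    (hw : IsMedianCenter P X p w) (hpos : ∀ᵐ ω ∂P, 0 < sqDist X w (Finset.range p) ω)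
    (hint : Integrable (fun ω => √((p : ℝ) / sqDist X w (Finset.range p) ω)) P) :
    1 / √(1 + C) ≤ ∫ ω, √((p : ℝ) / sqDist X w (Finset.range p) ω) ∂P := by
  have hC := h.C_pos
  have hp' : (0 : ℝ) < p := by exact_mod_cast hp
  set t := √(p * (1 + C)) with ht
  have ht0 : 0 < t := by positivity
  have hEt : ∫ ω, √(sqDist X w (Finset.range p) ω) ∂P ≤ t :=
    (hw.le _).trans (h.integral_sqrt_sqDist_mean_le hp)
  have hsi := integrable_sqrt (h.integrable_sqDist w (Finset.range p)) (sqDist_nonneg _ _)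
  have e : √(p : ℝ) / t = 1 / √(1 + C) := by
    rw [ht, Real.sqrt_mul hp'.le]
    have : 0 < √(p : ℝ) := Real.sqrt_pos.2 hp'
    field_simp
  calc 1 / √(1 + C) = √(p : ℝ) * (2 / t) - √(p : ℝ) / t ^ 2 * t := by
        rw [← e]
        field_simp
        ring
    _ ≤ √(p : ℝ) * (2 / t) -
          √(p : ℝ) / t ^ 2 * ∫ ω, √(sqDist X w (Finset.range p) ω) ∂P := by gcongr
    _ = ∫ ω, (√(p : ℝ) * (2 / t) - √(p : ℝ) / t ^ 2 * √(sqDist X w (Finset.range p) ω)) ∂P := by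
        rw [integral_sub (integrable_const _) (hsi.const_mul _), integral_const,
          integral_const_mul, probReal_univ, one_smul]
    _ ≤ ∫ ω, √((p : ℝ) / sqDist X w (Finset.range p) ω) ∂P := by
        refine integral_mono_ae ((integrable_const _).sub (hsi.const_mul _)) hint ?_
        filter_upwards [hpos] with ω hω
        rw [Real.sqrt_div hp'.le]
        set r := √(sqDist X w (Finset.range p) ω) with hr
        have hr0 : 0 < r := Real.sqrt_pos.2 hω
        have : 2 / t - r / t ^ 2 ≤ 1 / r := by
          rw [div_sub_div _ _ ht0.ne' (by positivity), div_le_div_iff₀ (by positivity) hr0]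
          nlinarith [mul_nonneg ht0.le (sq_nonneg (t - r))]
        calc √(p : ℝ) * (2 / t) - √(p : ℝ) / t ^ 2 * r = √(p : ℝ) * (2 / t - r / t ^ 2) := by ring
          _ ≤ √(p : ℝ) * (1 / r) := by gcongr
          _ = √(p : ℝ) / r := by ring

/-- Integrability of `√(p / N)` and of its product with a centred variable. -/
lemma integrable_sqrt_div (h : ClassD P M q c σmin C X) {p : ℕ} {w : ℕ → ℝ} {s : Finset ℕ}
    (hint : Integrable (fun ω => (p : ℝ) / sqDist X w s ω) P) (i : ℕ) :
    Integrable (fun ω => √((p : ℝ) / sqDist X w s ω)) P ∧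
      Integrable (fun ω => centered P X i ω * √((p : ℝ) / sqDist X w s ω)) P ∧
      ∫ ω, |centered P X i ω * √((p : ℝ) / sqDist X w s ω)| ∂P ≤
        1 + C + ∫ ω, (p : ℝ) / sqDist X w s ω ∂P := by
  have h0 : ∀ ω, 0 ≤ (p : ℝ) / sqDist X w s ω := fun ω =>
    div_nonneg (Nat.cast_nonneg _) (sqDist_nonneg _ _ _)
  have h1 := integrable_sqrt hint h0
  have hle : ∀ ω, |centered P X i ω * √((p : ℝ) / sqDist X w s ω)| ≤
      centered P X i ω ^ 2 + (p : ℝ) / sqDist X w s ω := fun ω => by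
    have := Real.sq_sqrt (h0 ω)
    rw [abs_mul, abs_of_nonneg (Real.sqrt_nonneg _), ← sq_abs (centered P X i ω)]
    nlinarith [sq_nonneg (|centered P X i ω| - √((p : ℝ) / sqDist X w s ω)),
      abs_nonneg (centered P X i ω), Real.sqrt_nonneg ((p : ℝ) / sqDist X w s ω)]
  have hdom : Integrable (fun ω => centered P X i ω ^ 2 + (p : ℝ) / sqDist X w s ω) P :=
    (h.integrable_centered_sq i).add hint
  have h2 : Integrable (fun ω => centered P X i ω * √((p : ℝ) / sqDist X w s ω)) P :=
    hdom.mono' ((h.measurable_centered i).aestronglyMeasurable.mul h1.aestronglyMeasurable)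
      (ae_of_all _ hle)
  refine ⟨h1, h2, ?_⟩
  calc ∫ ω, |centered P X i ω * √((p : ℝ) / sqDist X w s ω)| ∂P
      ≤ ∫ ω, (centered P X i ω ^ 2 + (p : ℝ) / sqDist X w s ω) ∂P :=
        integral_mono h2.abs hdom hle
    _ = ∫ ω, centered P X i ω ^ 2 ∂P + ∫ ω, (p : ℝ) / sqDist X w s ω ∂P :=
        integral_add (h.integrable_centered_sq i) hint
    _ ≤ _ := by
        gcongr
        exact h.integral_centered_sq_le i

/-- The first-order condition, solved for the deviation of the median from the mean. -/
lemma sub_mul_integral_eq (h : ClassD P M q c σmin C X) {p : ℕ} {w : ℕ → ℝ}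
    (hw : IsMedianCenter P X p w)
    (hint : Integrable (fun ω => (p : ℝ) / sqDist X w (Finset.range p) ω) P) {i : ℕ} (hi : i < p) :
    (w i - ∫ ω, X i ω ∂P) * ∫ ω, √((p : ℝ) / sqDist X w (Finset.range p) ω) ∂P =
      ∫ ω, centered P X i ω * √((p : ℝ) / sqDist X w (Finset.range p) ω) ∂P := by
  obtain ⟨h1, h2, -⟩ := h.integrable_sqrt_div hint i
  have h0 : ∫ ω, √(p : ℝ) * ((X i ω - w i) / √(sqDist X w (Finset.range p) ω)) ∂P = 0 := by
    rw [integral_const_mul, hw.integral_eq_zero i hi, mul_zero]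
  have e : (fun ω => √(p : ℝ) * ((X i ω - w i) / √(sqDist X w (Finset.range p) ω))) = fun ω =>
      centered P X i ω * √((p : ℝ) / sqDist X w (Finset.range p) ω) -
        (w i - ∫ ω, X i ω ∂P) * √((p : ℝ) / sqDist X w (Finset.range p) ω) := by
    ext ω
    rw [Real.sqrt_div (Nat.cast_nonneg p)]
    simp only [centered]
    ring
  rw [e, integral_sub h2 (h1.const_mul _), integral_const_mul] at h0
  linarith

/-- A first bound, uniform in `i < p`, by the Cauchy–Schwarz inequality. -/
lemma exists_abs_sub_mean_le (h : ClassD P M q c σmin C X) : ∃ (A : ℝ) (p₀ : ℕ), 0 ≤ A ∧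
    ∀ p ≥ p₀, ∀ w, IsMedianCenter P X p w → ∀ i < p, |w i - ∫ ω, X i ω ∂P| ≤ A := by
  obtain ⟨B, p₀, hB⟩ := h.exists_negMoment_bound 1 0 one_pos
  have hC := h.C_pos
  have hB0 : 0 ≤ B := by
    obtain ⟨-, -, h1⟩ := hB p₀ le_rfl ∅ (by simp) 0
    refine le_trans (integral_nonneg fun ω => ?_) h1
    exact pow_nonneg (div_nonneg (Nat.cast_nonneg _) (sqDist_nonneg _ _ _)) _
  refine ⟨√(1 + C) * (1 + C + B), p₀, by positivity, fun p hp w hw i hi => ?_⟩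
  obtain ⟨hpos, hint, hle⟩ := hB p hp ∅ (by simp) w
  simp only [Finset.sdiff_empty, pow_one] at hpos hint hle
  obtain ⟨h1, h2, h3⟩ := h.integrable_sqrt_div hint i
  have hlow := h.one_div_sqrt_le_integral (by omega) hw hpos h1
  have key := h.sub_mul_integral_eq hw hint hi
  set I := ∫ ω, √((p : ℝ) / sqDist X w (Finset.range p) ω) ∂P with hI
  have hs : 0 < √(1 + C) := by positivity
  have hI0 : 0 < I := lt_of_lt_of_le (by positivity) hlow
  have habs : |w i - ∫ ω, X i ω ∂P| * I ≤ 1 + C + B := by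
    have : |w i - ∫ ω, X i ω ∂P| * I = |(w i - ∫ ω, X i ω ∂P) * I| := by
      rw [abs_mul, abs_of_pos hI0]
    rw [this, key]
    exact abs_integral_le_integral_abs.trans (h3.trans (by linarith))
  have hone : 1 ≤ √(1 + C) * I := by
    rw [div_le_iff₀ hs] at hlow
    linarith
  calc |w i - ∫ ω, X i ω ∂P| ≤ |w i - ∫ ω, X i ω ∂P| * (√(1 + C) * I) :=
        le_mul_of_one_le_right (abs_nonneg _) hone
    _ = √(1 + C) * (|w i - ∫ ω, X i ω ∂P| * I) := by ring
    _ ≤ √(1 + C) * (1 + C + B) := by gcongr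

lemma integrable_add_add_rpow (h : ClassD P M q c σmin C X) {A : ℝ} (hA : 0 ≤ A) (i j : ℕ) :
    Integrable (fun ω => (|centered P X i ω| + |centered P X j ω| + A) ^ q) P ∧
      ∫ ω, (|centered P X i ω| + |centered P X j ω| + A) ^ q ∂P ≤ 3 ^ q * (C + C + A ^ q) := by
  have hq0 : 0 ≤ q := by linarith [h.two_le_q]
  have hle : ∀ ω, (|centered P X i ω| + |centered P X j ω| + A) ^ q ≤
      3 ^ q * (|centered P X i ω| ^ q + |centered P X j ω| ^ q + A ^ q) := fun ω =>
    add_add_rpow_le hq0 (abs_nonneg _) (abs_nonneg _) hA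
  have i1 : Integrable (fun ω => |centered P X i ω| ^ q + |centered P X j ω| ^ q) P :=
    (h.integrable_abs_rpow_centered i).add (h.integrable_abs_rpow_centered j)
  have hdom : Integrable (fun ω => 3 ^ q * (|centered P X i ω| ^ q + |centered P X j ω| ^ q +
      A ^ q)) P := (i1.add (integrable_const _)).const_mul _
  have hm : Measurable (fun ω => (|centered P X i ω| + |centered P X j ω| + A) ^ q) := by
    have h1 := h.measurable_centered i
    have h2 := h.measurable_centered j
    fun_prop
  have hint : Integrable (fun ω => (|centered P X i ω| + |centered P X j ω| + A) ^ q) P :=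
    hdom.mono' hm.aestronglyMeasurable (ae_of_all _ fun ω => by
      rw [Real.norm_of_nonneg (by positivity)]
      exact hle ω)
  refine ⟨hint, (integral_mono hint hdom hle).trans ?_⟩
  rw [integral_const_mul, integral_add i1 (integrable_const _),
    integral_add (h.integrable_abs_rpow_centered i) (h.integrable_abs_rpow_centered j)]
  simp only [integral_const, probReal_univ, one_smul]
  gcongr
  · exact h.integral_abs_rpow_centered_le i
  · exact h.integral_abs_rpow_centered_le j

end ClassD

/-- The divided difference of `1 / √·` between the squared distances, divided by `p`, computed
without and with the indices in the exclusion set of `i`. -/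
noncomputable def distSlope (M : ℕ) (X : ℕ → Ω → ℝ) (w : ℕ → ℝ) (p i : ℕ) (ω : Ω) : ℝ :=
  invSqrtSlope (sqDist X w (Finset.range p \ exclusionSet M i) ω / p)
    (sqDist X w (Finset.range p) ω / p)

omit [MeasurableSpace Ω] in
lemma sqDist_sdiff_add (w : ℕ → ℝ) (p i : ℕ) (ω : Ω) :
    sqDist X w (Finset.range p) ω - sqDist X w (Finset.range p \ exclusionSet M i) ω =
      ∑ j ∈ Finset.range p ∩ exclusionSet M i, (X j ω - w j) ^ 2 := by
  simp only [sqDist]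
  rw [← Finset.sum_inter_add_sum_sdiff (Finset.range p) (exclusionSet M i)]
  ring

omit [MeasurableSpace Ω] in
lemma distSlope_nonneg (w : ℕ → ℝ) (p i : ℕ) (ω : Ω) : 0 ≤ distSlope M X w p i ω :=
  invSqrtSlope_nonneg _ _

lemma card_exclusionSet_le (M i : ℕ) : (exclusionSet M i).card ≤ 2 * M + 1 := by
  rw [exclusionSet, Nat.card_Icc]
  omega

namespace ClassD

variable [IsProbabilityMeasure P]

omit [IsProbabilityMeasure P] in
lemma measurable_distSlope (h : ClassD P M q c σmin C X) (w : ℕ → ℝ) (p i : ℕ) :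
    Measurable (distSlope M X w p i) :=
  measurable_invSqrtSlope.comp (((measurable_sqDist h.measurable _ _).div_const _).prodMk
    ((measurable_sqDist h.measurable _ _).div_const _))

lemma exists_distSlope_moment_bound (h : ClassD P M q c σmin C X) {m : ℕ} (hm : 0 < m) :
    ∃ (B : ℝ) (p₀ : ℕ), ∀ p ≥ p₀, ∀ (w : ℕ → ℝ) (i : ℕ),
      Integrable (fun ω => distSlope M X w p i ω ^ (2 * m)) P ∧
        ∫ ω, distSlope M X w p i ω ^ (2 * m) ∂P ≤ B := by
  obtain ⟨B, p₀, hB⟩ := h.exists_negMoment_bound (3 * m) (2 * M + 1) (by omega)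
  refine ⟨B, p₀ + 1, fun p hp w i => ?_⟩
  obtain ⟨hpos, hint, hle⟩ := hB p (by omega) _ (card_exclusionSet_le M i) w
  have hp' : (0 : ℝ) < p := by exact_mod_cast (show 0 < p by omega)
  have hae : ∀ᵐ ω ∂P, distSlope M X w p i ω ^ (2 * m) ≤
      ((p : ℝ) / sqDist X w (Finset.range p \ exclusionSet M i) ω) ^ (3 * m) := by
    filter_upwards [hpos] with ω hω
    rw [pow_mul, pow_mul]
    refine pow_le_pow_left₀ (sq_nonneg _) ?_ m
    refine (invSqrtSlope_sq_le (by positivity) ?_).trans_eq (by rw [one_div_div])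
    gcongr
    rw [← sub_nonneg, sqDist_sdiff_add]
    exact Finset.sum_nonneg fun _ _ => sq_nonneg _
  have hsi : Integrable (fun ω => distSlope M X w p i ω ^ (2 * m)) P := by
    refine hint.mono' ((h.measurable_distSlope w p i).pow_const _).aestronglyMeasurable ?_
    filter_upwards [hae] with ω hω
    rwa [Real.norm_of_nonneg (pow_nonneg (distSlope_nonneg _ _ _ _) _)]
  exact ⟨hsi, (integral_mono_ae hsi hint hae).trans hle⟩

omit [IsProbabilityMeasure P] in
lemma abs_centered_mul_sub_sq_le {A : ℝ} {w : ℕ → ℝ} {j : ℕ}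
    (hA : |w j - ∫ ω, X j ω ∂P| ≤ A) (i : ℕ) (ω : Ω) :
    |centered P X i ω * (X j ω - w j) ^ 2| ≤
      (|centered P X i ω| + |centered P X j ω| + A) ^ 3 := by
  have hA0 : 0 ≤ A := (abs_nonneg _).trans hA
  have h1 : |X j ω - w j| ≤ |centered P X j ω| + A := by
    have e : X j ω - w j = centered P X j ω - (w j - ∫ ω', X j ω' ∂P) := by
      simp only [centered]
      ring
    rw [e]
    exact (abs_sub _ _).trans (by linarith)
  have h2 := abs_nonneg (centered P X i ω)
  have h3 := abs_nonneg (centered P X j ω)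
  set Z := |centered P X i ω| + |centered P X j ω| + A with hZ
  rw [abs_mul, abs_pow]
  calc |centered P X i ω| * |X j ω - w j| ^ 2 ≤ Z * Z ^ 2 := by
        gcongr
        · linarith
        · linarith
    _ = Z ^ 3 := by ring

/-- Each term of the expansion of the first-order condition is integrable, with a bound that is
uniform in `i`, `j` and `p`. -/
lemma exists_term_bound (h : ClassD P M q c σmin C X) (hq : 3 < q) {A : ℝ} (hA : 0 ≤ A) :
    ∃ (D : ℝ) (p₀ : ℕ), ∀ p ≥ p₀, ∀ (w : ℕ → ℝ) (i j : ℕ), |w j - ∫ ω, X j ω ∂P| ≤ A →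
      Integrable (fun ω => centered P X i ω * (X j ω - w j) ^ 2 * distSlope M X w p i ω) P ∧
        |∫ ω, centered P X i ω * (X j ω - w j) ^ 2 * distSlope M X w p i ω ∂P| ≤ D := by
  obtain ⟨m, hm, hmq⟩ := exists_slope_exponent hq
  obtain ⟨B, p₀, hB⟩ := h.exists_distSlope_moment_bound hm
  obtain ⟨K, -, hK⟩ := exists_mul_le_mul_rpow_add_pow (s := q / 3) (by linarith)
    (show 0 < 2 * m by omega) hmq one_pos
  refine ⟨3 ^ q * (C + C + A ^ q) + B + K, p₀, fun p hp w i j hj => ?_⟩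
  obtain ⟨hsi, hsB⟩ := hB p hp w i
  obtain ⟨hZi, hZB⟩ := h.integrable_add_add_rpow hA i j
  set Z : Ω → ℝ := fun ω => |centered P X i ω| + |centered P X j ω| + A with hZ
  have hZ0 : ∀ ω, 0 ≤ Z ω := fun ω => by positivity
  have hle : ∀ ω, ‖centered P X i ω * (X j ω - w j) ^ 2 * distSlope M X w p i ω‖ ≤
      Z ω ^ q + distSlope M X w p i ω ^ (2 * m) + K := fun ω => by
    have hs0 : 0 ≤ distSlope M X w p i ω := distSlope_nonneg _ _ _ _
    rw [Real.norm_eq_abs, abs_mul, abs_of_nonneg hs0]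
    refine (mul_le_mul_of_nonneg_right (abs_centered_mul_sub_sq_le hj i ω) hs0).trans ?_
    refine (hK _ _ (pow_nonneg (hZ0 ω) 3) hs0).trans_eq ?_
    rw [one_mul, ← Real.rpow_natCast (Z ω) 3, ← Real.rpow_mul (hZ0 ω)]
    congr 3
    push_cast
    ring
  have i1 : Integrable (fun ω => Z ω ^ q + distSlope M X w p i ω ^ (2 * m)) P := hZi.add hsi
  have hdom : Integrable (fun ω => Z ω ^ q + distSlope M X w p i ω ^ (2 * m) + K) P :=
    i1.add (integrable_const K)
  have hmeas : Measurable (fun ω => centered P X i ω * (X j ω - w j) ^ 2 * distSlope M X w p i ω) :=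
    ((h.measurable_centered i).mul (((h.measurable j).sub_const _).pow_const 2)).mul
      (h.measurable_distSlope w p i)
  refine ⟨hdom.mono' hmeas.aestronglyMeasurable (ae_of_all _ hle), ?_⟩
  refine (norm_integral_le_of_norm_le hdom (ae_of_all _ hle)).trans ?_
  rw [integral_add i1 (integrable_const K), integral_add hZi hsi]
  simp only [integral_const, probReal_univ, one_smul]
  linarith

/-- The exact expansion behind the theorem. Since `X i` is independent of the squared distance `R`
over the indices outside the exclusion set, `E[(X i - μ i) / √R] = 0`, and only the difference
`1 / √N - 1 / √R` enters the first-order condition. -/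
lemma exists_mul_sub_mul_integral_eq (h : ClassD P M q c σmin C X) (hq : 3 < q) {A : ℝ}
    (hA : 0 ≤ A) : ∃ p₀ : ℕ, ∀ p ≥ p₀, ∀ w, IsMedianCenter P X p w →
      (∀ j < p, |w j - ∫ ω, X j ω ∂P| ≤ A) → ∀ i < p,
      p * (w i - ∫ ω, X i ω ∂P) * ∫ ω, √((p : ℝ) / sqDist X w (Finset.range p) ω) ∂P =
        -∑ j ∈ Finset.range p ∩ exclusionSet M i,
          ∫ ω, centered P X i ω * (X j ω - w j) ^ 2 * distSlope M X w p i ω ∂P := by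
  obtain ⟨D, p₁, hD⟩ := h.exists_term_bound hq hA
  obtain ⟨B, p₂, hB⟩ := h.exists_negMoment_bound 1 (2 * M + 1) one_pos
  refine ⟨max p₁ p₂, fun p hp w hw hwA i hi => ?_⟩
  have hp' : (0 : ℝ) < p := by exact_mod_cast (show 0 < p by omega)
  obtain ⟨hNpos, hNint, -⟩ := hB p ((le_max_right _ _).trans hp) ∅ (by simp) w
  obtain ⟨hRpos, hRint, -⟩ := hB p ((le_max_right _ _).trans hp) _ (card_exclusionSet_le M i) w
  simp only [Finset.sdiff_empty, pow_one] at hNpos hNint hRpos hRint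
  obtain ⟨-, hNF, -⟩ := h.integrable_sqrt_div hNint i
  obtain ⟨hR1, hRF, -⟩ := h.integrable_sqrt_div hRint i
  have hindep : ∫ ω, centered P X i ω *
      √((p : ℝ) / sqDist X w (Finset.range p \ exclusionSet M i) ω) ∂P = 0 := by
    have hI := (h.mDependent.indepFun_sqDist h.measurable i w
      (Finset.range p \ exclusionSet M i) Finset.sdiff_disjoint).comp
      (φ := fun x => x - ∫ ω', X i ω' ∂P) (ψ := fun x => √((p : ℝ) / x))
      (by fun_prop) (by fun_prop)
    have := hI.integral_fun_mul_eq_mul_integral (h.measurable_centered i).aestronglyMeasurable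
      hR1.aestronglyMeasurable
    simp only [Function.comp] at this
    refine this.trans ?_
    rw [show (∫ ω, (X i ω - ∫ ω', X i ω' ∂P) ∂P) = 0 from h.integral_centered i, zero_mul]
  have hterm : ∀ j ∈ Finset.range p ∩ exclusionSet M i,
      Integrable (fun ω => centered P X i ω * (X j ω - w j) ^ 2 * distSlope M X w p i ω) P :=
    fun j hj => (hD p ((le_max_left _ _).trans hp) w i j
      (hwA j (Finset.mem_range.1 (Finset.mem_inter.1 hj).1))).1
  rw [mul_assoc, h.sub_mul_integral_eq hw hNint hi, ← integral_finsetSum _ hterm]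
  rw [← sub_zero (∫ ω, centered P X i ω * √((p : ℝ) / sqDist X w (Finset.range p) ω) ∂P),
    ← hindep, ← integral_sub hNF hRF, ← integral_const_mul, ← integral_neg]
  refine integral_congr_ae ?_
  filter_upwards [hNpos, hRpos] with ω hN hR
  have e := inv_sqrt_sub_inv_sqrt (div_pos hR hp') (div_pos hN hp')
  rw [← sub_div, sqDist_sdiff_add] at e
  rw [sqrt_div_eq_one_div_sqrt _ (sqDist X w (Finset.range p) ω),
    sqrt_div_eq_one_div_sqrt _ (sqDist X w (Finset.range p \ exclusionSet M i) ω), ← Finset.sum_mul, ← Finset.mul_sum]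
  simp only [distSlope]
  field_simp at e ⊢
  linear_combination (-centered P X i ω) * e

/-- The deviation of the median from the mean is `O(1 / p)`, uniformly over the coordinates. -/
theorem exists_abs_sub_mean_le_div (h : ClassD P M q c σmin C X) (hq : 3 < q) :
    ∃ (A : ℝ) (p₀ : ℕ), 0 ≤ A ∧
      ∀ p ≥ p₀, ∀ w, IsMedianCenter P X p w → ∀ i < p, |w i - ∫ ω, X i ω ∂P| ≤ A / p := by
  obtain ⟨A, p₁, hA, hwA⟩ := h.exists_abs_sub_mean_le
  obtain ⟨D, p₂, hD⟩ := h.exists_term_bound hq hA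
  obtain ⟨p₃, hE⟩ := h.exists_mul_sub_mul_integral_eq hq hA
  obtain ⟨B, p₄, hB⟩ := h.exists_negMoment_bound 1 0 one_pos
  have hC := h.C_pos
  refine ⟨√(1 + C) * ((2 * M + 1) * |D|), max (max p₁ p₂) (max p₃ p₄), by positivity,
    fun p hp w hw i hi => ?_⟩
  have hp₁ : p₁ ≤ p := by omega
  have hp₂ : p₂ ≤ p := by omega
  have hp₃ : p₃ ≤ p := by omega
  have hp₄ : p₄ ≤ p := by omega
  have hp' : (0 : ℝ) < p := by exact_mod_cast (show 0 < p by omega)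
  obtain ⟨hpos, hint, -⟩ := hB p hp₄ ∅ (by simp) w
  simp only [Finset.sdiff_empty, pow_one] at hpos hint
  obtain ⟨h1, -, -⟩ := h.integrable_sqrt_div hint i
  have hlow := h.one_div_sqrt_le_integral (by omega) hw hpos h1
  have key := hE p hp₃ w hw (hwA p hp₁ w hw) i hi
  set I := ∫ ω, √((p : ℝ) / sqDist X w (Finset.range p) ω) ∂P with hI
  have hs : 0 < √(1 + C) := by positivity
  have hI0 : 0 < I := lt_of_lt_of_le (by positivity) hlow
  have hone : 1 ≤ √(1 + C) * I := by
    rw [div_le_iff₀ hs] at hlow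
    linarith
  have hsum : |p * (w i - ∫ ω, X i ω ∂P) * I| ≤ (2 * M + 1) * |D| := by
    rw [key, abs_neg]
    refine (Finset.abs_sum_le_sum_abs _ _).trans ?_
    calc _ ≤ ∑ j ∈ Finset.range p ∩ exclusionSet M i, |D| := by
          refine Finset.sum_le_sum fun j hj => ?_
          exact (hD p hp₂ w i j (hwA p hp₁ w hw j
            (Finset.mem_range.1 (Finset.mem_inter.1 hj).1))).2.trans (le_abs_self D)
      _ ≤ (2 * M + 1) * |D| := by
          rw [Finset.sum_const, nsmul_eq_mul]
          gcongr
          exact_mod_cast (Finset.card_le_card Finset.inter_subset_right).trans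
            (card_exclusionSet_le M i)
  rw [abs_mul, abs_mul, abs_of_pos hp', abs_of_pos hI0] at hsum
  rw [le_div_iff₀ hp']
  calc |w i - ∫ ω, X i ω ∂P| * p ≤ |w i - ∫ ω, X i ω ∂P| * p * (√(1 + C) * I) :=
        le_mul_of_one_le_right (by positivity) hone
    _ = √(1 + C) * (p * |w i - ∫ ω, X i ω ∂P| * I) := by ring
    _ ≤ _ := by gcongr

end ClassD

end MedianCenter

/-! ### Asymptotic expansion of the coordinates of the median -/

section Expansion

variable {Ω : Type*} [MeasurableSpace Ω] {P : Measure Ω} [IsProbabilityMeasure P] {M : ℕ}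
  {q c σmin C : ℝ} {X : ℕ → Ω → ℝ}

namespace ClassD

lemma integral_two_mul_abs_centered_le (h : ClassD P M q c σmin C X) (j : ℕ) :
    ∫ ω, 2 * |centered P X j ω| ∂P ≤ 2 + C := by
  calc ∫ ω, 2 * |centered P X j ω| ∂P ≤ ∫ ω, (1 + centered P X j ω ^ 2) ∂P := by
        refine integral_mono ((h.integrable_centered j).abs.const_mul 2)
          ((integrable_const 1).add (h.integrable_centered_sq j)) fun ω => ?_
        simp only
        rw [← sq_abs (centered P X j ω)]
        nlinarith [sq_nonneg (|centered P X j ω| - 1)]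
    _ = 1 + ∫ ω, centered P X j ω ^ 2 ∂P := by
        rw [integral_add (integrable_const 1) (h.integrable_centered_sq j)]
        simp
    _ ≤ 2 + C := by linarith [h.integral_centered_sq_le j]

variable {w : ℕ → ℕ → ℝ} {τ : ℝ}

/-- The law of large numbers for `N / p`. The centre moves by `O(1 / p)` per coordinate, so that
replacing the mean by the median does not matter in the limit. -/
lemma tendsto_integral_abs_sqDist_div_sub (h : ClassD P M q c σmin C X) (hq : 3 < q)
    (hw : ∀ p ≥ M + 2, IsMedianCenter P X p (w p))
    (hτ : Tendsto (fun p : ℕ => (1 / (p : ℝ)) * ∑ j ∈ Finset.range p, variance (X j) P)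
      atTop (𝓝 τ)) :
    Tendsto (fun p : ℕ => ∫ ω, |sqDist X (w p) (Finset.range p) ω / p - τ| ∂P) atTop (𝓝 0) := by
  obtain ⟨A, p₀, hA, hwA⟩ := h.exists_abs_sub_mean_le_div hq
  have hAp : Tendsto (fun p : ℕ => A / (p : ℝ)) atTop (𝓝 0) :=
    tendsto_const_div_atTop_nhds_zero_nat A
  have hvar : Tendsto (fun p : ℕ =>
      |(1 / (p : ℝ)) * ∑ j ∈ Finset.range p, variance (X j) P - τ|) atTop (𝓝 0) := by
    simpa using (hτ.sub_const τ).abs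
  have hlim := ((h.tendsto_integral_abs_sum_sq_sub hq.le).add hvar).add
    ((hAp.mul_const (2 + C)).add (hAp.pow 2))
  simp only [add_zero, zero_mul, ne_eq, OfNat.ofNat_ne_zero, not_false_eq_true, zero_pow] at hlim
  refine squeeze_zero' (Eventually.of_forall fun p => integral_nonneg fun ω => abs_nonneg _) ?_ hlim
  filter_upwards [eventually_ge_atTop (max p₀ (M + 2))] with p hp
  have hp0 : p₀ ≤ p := (le_max_left _ _).trans hp
  have hpM : M + 2 ≤ p := (le_max_right _ _).trans hp
  have hp' : (0 : ℝ) < p := by exact_mod_cast (show 0 < p by omega)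
  have ha := hwA p hp0 _ (hw p hpM)
  have hAp0 : 0 ≤ A / p := by positivity
  have iL : Integrable (fun ω =>
      |∑ j ∈ Finset.range p, (centered P X j ω ^ 2 - variance (X j) P)|) P :=
    (integrable_finsetSum _ fun j _ => (h.integrable_centered_sq j).sub (integrable_const _)).abs
  have iY : ∀ j, Integrable (fun ω => 2 * |centered P X j ω|) P := fun j =>
    (h.integrable_centered j).abs.const_mul 2
  have iYA : ∀ j, Integrable (fun ω => A / p * (2 * |centered P X j ω|) + (A / p) ^ 2) P :=
    fun j => ((iY j).const_mul _).add (integrable_const _)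
  have iS : Integrable (fun ω => ∑ j ∈ Finset.range p,
      (A / p * (2 * |centered P X j ω|) + (A / p) ^ 2)) P :=
    integrable_finsetSum _ fun j _ => iYA j
  have iLV : Integrable (fun ω =>
      |∑ j ∈ Finset.range p, (centered P X j ω ^ 2 - variance (X j) P)| / p +
        |(1 / (p : ℝ)) * ∑ j ∈ Finset.range p, variance (X j) P - τ|) P :=
    (iL.div_const _).add (integrable_const _)
  calc ∫ ω, |sqDist X (w p) (Finset.range p) ω / p - τ| ∂P
      ≤ ∫ ω, (|∑ j ∈ Finset.range p, (centered P X j ω ^ 2 - variance (X j) P)| / p +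
          |(1 / (p : ℝ)) * ∑ j ∈ Finset.range p, variance (X j) P - τ| +
          (∑ j ∈ Finset.range p, (A / p * (2 * |centered P X j ω|) + (A / p) ^ 2)) / p) ∂P := by
        refine integral_mono (((h.integrable_sqDist _ _).div_const _).sub (integrable_const _)).abs
          (iLV.add (iS.div_const _)) fun ω => ?_
        have e : sqDist X (w p) (Finset.range p) ω / p - τ =
            (∑ j ∈ Finset.range p, (centered P X j ω ^ 2 - variance (X j) P)) / p +
            ((1 / (p : ℝ)) * ∑ j ∈ Finset.range p, variance (X j) P - τ) +
            (∑ j ∈ Finset.range p, ((X j ω - w p j) ^ 2 - centered P X j ω ^ 2)) / p := by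
          rw [sqDist, Finset.sum_sub_distrib, Finset.sum_sub_distrib]
          field_simp
          ring
        have hd : |∑ j ∈ Finset.range p, ((X j ω - w p j) ^ 2 - centered P X j ω ^ 2)| ≤
            ∑ j ∈ Finset.range p, (A / p * (2 * |centered P X j ω|) + (A / p) ^ 2) := by
          refine (Finset.abs_sum_le_sum_abs _ _).trans (Finset.sum_le_sum fun j hj => ?_)
          have haj := ha j (Finset.mem_range.1 hj)
          set a := w p j - ∫ ω', X j ω' ∂P with hadef
          have e' : (X j ω - w p j) ^ 2 - centered P X j ω ^ 2 =
              -(a * (2 * centered P X j ω)) + a ^ 2 := by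
            simp only [centered, hadef]
            ring
          rw [e']
          refine (abs_add_le _ _).trans ?_
          rw [abs_neg, abs_mul, abs_mul, abs_pow, abs_two]
          gcongr
        simp only
        rw [e]
        refine (abs_add_three _ _ _).trans ?_
        rw [abs_div, abs_div, abs_of_pos hp']
        gcongr
    _ = (∫ ω, |∑ j ∈ Finset.range p, (centered P X j ω ^ 2 - variance (X j) P)| ∂P) / p +
          |(1 / (p : ℝ)) * ∑ j ∈ Finset.range p, variance (X j) P - τ| +
          (∑ j ∈ Finset.range p, (A / p * ∫ ω, 2 * |centered P X j ω| ∂P + (A / p) ^ 2)) / p := by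
        rw [integral_add iLV (iS.div_const _), integral_add (iL.div_const _) (integrable_const _),
          integral_div, integral_div,
          integral_finsetSum _ fun j _ => iYA j]
        congr 2
        · simp
        · refine Finset.sum_congr rfl fun j _ => ?_
          rw [integral_add ((iY j).const_mul _) (integrable_const _), integral_const_mul]
          simp
    _ ≤ (∫ ω, |∑ j ∈ Finset.range p, (centered P X j ω ^ 2 - variance (X j) P)| ∂P) / p +
          |(1 / (p : ℝ)) * ∑ j ∈ Finset.range p, variance (X j) P - τ| +
          (∑ j ∈ Finset.range p, (A / p * (2 + C) + (A / p) ^ 2)) / p := by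
        gcongr with j _
        exact h.integral_two_mul_abs_centered_le j
    _ = _ := by
        rw [Finset.sum_const, Finset.card_range, nsmul_eq_mul]
        congr 1
        field_simp

/-- Removing the boundedly many indices of the exclusion set does not change the limit. -/
lemma tendsto_integral_abs_sqDist_sdiff_div_sub (h : ClassD P M q c σmin C X) (hq : 3 < q)
    (hw : ∀ p ≥ M + 2, IsMedianCenter P X p (w p))
    (hτ : Tendsto (fun p : ℕ => (1 / (p : ℝ)) * ∑ j ∈ Finset.range p, variance (X j) P)
      atTop (𝓝 τ)) (i : ℕ) :
    Tendsto (fun p : ℕ =>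
      ∫ ω, |sqDist X (w p) (Finset.range p \ exclusionSet M i) ω / p - τ| ∂P) atTop (𝓝 0) := by
  obtain ⟨A, p₀, hA, hwA⟩ := h.exists_abs_sub_mean_le
  have hC := h.C_pos
  have hlim := (h.tendsto_integral_abs_sqDist_div_sub hq hw hτ).add
    (tendsto_const_div_atTop_nhds_zero_nat ((2 * M + 1) * (2 * (1 + C) + 2 * A ^ 2)))
  rw [add_zero] at hlim
  refine squeeze_zero' (Eventually.of_forall fun p => integral_nonneg fun ω => abs_nonneg _) ?_ hlim
  filter_upwards [eventually_ge_atTop (max p₀ (M + 2))] with p hp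
  have hp0 : p₀ ≤ p := (le_max_left _ _).trans hp
  have hpM : M + 2 ≤ p := (le_max_right _ _).trans hp
  have hp' : (0 : ℝ) < p := by exact_mod_cast (show 0 < p by omega)
  have hj : ∀ j ∈ Finset.range p ∩ exclusionSet M i,
      ∫ ω, (X j ω - w p j) ^ 2 ∂P ≤ 2 * (1 + C) + 2 * A ^ 2 := by
    intro j hj
    have ha := hwA p hp0 _ (hw p hpM) j (Finset.mem_range.1 (Finset.mem_inter.1 hj).1)
    have ha2 : (w p j - ∫ ω, X j ω ∂P) ^ 2 ≤ A ^ 2 := by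
      rw [← sq_abs]
      exact pow_le_pow_left₀ (abs_nonneg _) ha 2
    calc ∫ ω, (X j ω - w p j) ^ 2 ∂P ≤ ∫ ω, (2 * centered P X j ω ^ 2 + 2 * A ^ 2) ∂P := by
          refine integral_mono (h.integrable_sub_sq j _)
            (((h.integrable_centered_sq j).const_mul 2).add (integrable_const _)) fun ω => ?_
          have e : X j ω - w p j = centered P X j ω - (w p j - ∫ ω', X j ω' ∂P) := by
            simp only [centered]
            ring
          simp only
          rw [e]
          nlinarith [sq_nonneg (centered P X j ω + (w p j - ∫ ω', X j ω' ∂P))]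
      _ = 2 * ∫ ω, centered P X j ω ^ 2 ∂P + 2 * A ^ 2 := by
          rw [integral_add ((h.integrable_centered_sq j).const_mul 2) (integrable_const _),
            integral_const_mul]
          simp
      _ ≤ _ := by
          gcongr
          exact h.integral_centered_sq_le j
  have iN : Integrable (fun ω => |sqDist X (w p) (Finset.range p) ω / p - τ|) P :=
    (((h.integrable_sqDist _ _).div_const _).sub (integrable_const _)).abs
  have iS : Integrable (fun ω =>
      (∑ j ∈ Finset.range p ∩ exclusionSet M i, (X j ω - w p j) ^ 2) / p) P :=
    (integrable_finsetSum _ fun j _ => h.integrable_sub_sq j _).div_const _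
  calc ∫ ω, |sqDist X (w p) (Finset.range p \ exclusionSet M i) ω / p - τ| ∂P
      ≤ ∫ ω, (|sqDist X (w p) (Finset.range p) ω / p - τ| +
          (∑ j ∈ Finset.range p ∩ exclusionSet M i, (X j ω - w p j) ^ 2) / p) ∂P := by
        refine integral_mono (((h.integrable_sqDist _ _).div_const _).sub (integrable_const _)).abs
          (iN.add iS) fun ω => ?_
        have e : sqDist X (w p) (Finset.range p \ exclusionSet M i) ω / p - τ =
            (sqDist X (w p) (Finset.range p) ω / p - τ) -
            (∑ j ∈ Finset.range p ∩ exclusionSet M i, (X j ω - w p j) ^ 2) / p := by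
          rw [← sqDist_sdiff_add]
          ring
        simp only
        rw [e]
        refine (abs_sub _ _).trans_eq ?_
        rw [abs_of_nonneg (div_nonneg (Finset.sum_nonneg fun _ _ => sq_nonneg _) hp'.le)]
    _ = ∫ ω, |sqDist X (w p) (Finset.range p) ω / p - τ| ∂P +
          (∑ j ∈ Finset.range p ∩ exclusionSet M i, ∫ ω, (X j ω - w p j) ^ 2 ∂P) / p := by
        rw [integral_add iN iS, integral_div,
          integral_finsetSum _ fun j _ => h.integrable_sub_sq j _]
    _ ≤ _ := by
        gcongr
        refine (Finset.sum_le_sum hj).trans ?_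
        rw [Finset.sum_const, nsmul_eq_mul]
        gcongr
        exact_mod_cast (Finset.card_le_card Finset.inter_subset_right).trans
          (card_exclusionSet_le M i)

lemma tendsto_integral_sqrt_div (h : ClassD P M q c σmin C X) (hq : 3 < q)
    (hw : ∀ p ≥ M + 2, IsMedianCenter P X p (w p)) (hτ0 : 0 < τ)
    (hτ : Tendsto (fun p : ℕ => (1 / (p : ℝ)) * ∑ j ∈ Finset.range p, variance (X j) P)
      atTop (𝓝 τ)) :
    Tendsto (fun p : ℕ => ∫ ω, √((p : ℝ) / sqDist X (w p) (Finset.range p) ω) ∂P)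
      atTop (𝓝 (1 / √τ)) := by
  obtain ⟨B, p₀, hB⟩ := h.exists_negMoment_bound 1 0 one_pos
  simp only [pow_one] at hB
  have hN := h.tendsto_integral_abs_sqDist_div_sub hq hw hτ
  have hNi : ∀ p : ℕ, Integrable (fun ω => sqDist X (w p) (Finset.range p) ω / p) P := fun p =>
    (h.integrable_sqDist _ _).div_const _
  have hint : ∀ p ≥ p₀, Integrable (fun ω => (p : ℝ) / sqDist X (w p) (Finset.range p) ω) P ∧
      ∫ ω, (p : ℝ) / sqDist X (w p) (Finset.range p) ω ∂P ≤ B := fun p hp => by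
    have := (hB p hp ∅ (by simp) (w p)).2
    simpa only [Finset.sdiff_empty] using this
  set H : ℕ → Ω → ℝ := fun p ω => 1 / √(sqDist X (w p) (Finset.range p) ω / p) - 1 / √τ with hH
  have hHm : ∀ p, Measurable (H p) := fun p => by
    have := measurable_sqDist h.measurable (w p) (Finset.range p)
    simp only [hH]
    fun_prop
  have hcont : ContinuousAt (fun z : ℝ × ℝ => 1 / √z.1) (τ, τ) := by
    have h1 : 0 < √τ := Real.sqrt_pos.2 hτ0
    refine ContinuousAt.div continuousAt_const (by fun_prop) ?_
    exact h1.ne'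
  have hHsq : ∀ p ω, |H p ω| ^ 2 ≤
      2 * ((p : ℝ) / sqDist X (w p) (Finset.range p) ω) + 2 * (1 / τ) := fun p ω => by
    have e1 : (√((p : ℝ) / sqDist X (w p) (Finset.range p) ω)) ^ 2 =
        (p : ℝ) / sqDist X (w p) (Finset.range p) ω :=
      Real.sq_sqrt (div_nonneg (Nat.cast_nonneg _) (sqDist_nonneg _ _ _))
    have e2 : (1 / √τ) ^ 2 = 1 / τ := by rw [div_pow, one_pow, Real.sq_sqrt hτ0.le]
    rw [sq_abs, ← e1, ← e2, hH]
    simp only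
    rw [← sqrt_div_eq_one_div_sqrt]
    nlinarith [sq_nonneg (√((p : ℝ) / sqDist X (w p) (Finset.range p) ω) + 1 / √τ)]
  have key := tendsto_integral_mul_zero (P := P) (s := 4) (k := 2) (by norm_num) (by norm_num)
    (by norm_num) (V := fun _ _ => 1) (H := H) (V₀ := fun _ => 1) (B := 2 * B + 2 * (1 / τ))
    (integrable_const _) (integrable_const _) (Eventually.of_forall fun p ω => by simp) hHm
    (by
      filter_upwards [eventually_ge_atTop p₀] with p hp
      have hdom : Integrable (fun ω =>
          2 * ((p : ℝ) / sqDist X (w p) (Finset.range p) ω) + 2 * (1 / τ)) P :=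
        ((hint p hp).1.const_mul 2).add (integrable_const _)
      have hi : Integrable (fun ω => |H p ω| ^ 2) P :=
        hdom.mono' ((hHm p).abs.pow_const 2).aestronglyMeasurable (ae_of_all _ fun ω => by
          rw [Real.norm_of_nonneg (by positivity)]
          exact hHsq p ω)
      refine ⟨hi, (integral_mono hi hdom (hHsq p)).trans ?_⟩
      rw [integral_add ((hint p hp).1.const_mul 2) (integrable_const _), integral_const_mul,
        integral_const, probReal_univ, one_smul]
      linarith [(hint p hp).2])
    (fun ε hε => tendsto_measureReal_le_abs_comp_sub (g := fun z : ℝ × ℝ => 1 / √z.1) hcont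
      hNi hNi hN hN hε)
  have h2 := key.add_const (1 / √τ)
  rw [zero_add] at h2
  refine h2.congr' ?_
  filter_upwards [eventually_ge_atTop p₀] with p hp
  obtain ⟨h1, -, -⟩ := h.integrable_sqrt_div (hint p hp).1 0
  have e : ∀ ω, (1 : ℝ) * H p ω =
      √((p : ℝ) / sqDist X (w p) (Finset.range p) ω) - 1 / √τ := fun ω => by
    rw [one_mul, sqrt_div_eq_one_div_sqrt]
  simp_rw [e]
  rw [integral_sub h1 (integrable_const _)]
  simp

lemma integrable_centered_mul (h : ClassD P M q c σmin C X) (i j : ℕ) :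
    Integrable (fun ω => centered P X i ω * centered P X j ω) P := by
  refine ((h.integrable_centered_sq i).add (h.integrable_centered_sq j)).mono'
    ((h.measurable_centered i).mul (h.measurable_centered j)).aestronglyMeasurable
    (ae_of_all _ fun ω => ?_)
  rw [Real.norm_eq_abs, abs_le, Pi.add_apply]
  constructor <;> nlinarith [sq_nonneg (centered P X i ω + centered P X j ω),
    sq_nonneg (centered P X i ω - centered P X j ω)]

lemma integrable_add_add_cube (h : ClassD P M q c σmin C X) (hq : 3 < q) {A : ℝ} (hA : 0 ≤ A)
    (i j : ℕ) :
    Integrable (fun ω => (|centered P X i ω| + |centered P X j ω| + A) ^ 3) P := by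
  have hm : Measurable (fun ω => (|centered P X i ω| + |centered P X j ω| + A) ^ 3) := by
    have h1 := h.measurable_centered i
    have h2 := h.measurable_centered j
    fun_prop
  refine ((integrable_const 1).add (h.integrable_add_add_rpow hA i j).1).mono'
    hm.aestronglyMeasurable (ae_of_all _ fun ω => ?_)
  have h0 : 0 ≤ |centered P X i ω| + |centered P X j ω| + A := by positivity
  have := pow_abs_le_one_add (n := 3) (q := q) (by exact_mod_cast hq.le)
    (|centered P X i ω| + |centered P X j ω| + A)
  rw [abs_of_nonneg h0] at this
  rwa [Real.norm_of_nonneg (by positivity)]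

/-- Limit of each term in the expansion of the first-order condition. -/
lemma tendsto_integral_term (h : ClassD P M q c σmin C X) (hq : 3 < q)
    (hw : ∀ p ≥ M + 2, IsMedianCenter P X p (w p)) (hτ0 : 0 < τ)
    (hτ : Tendsto (fun p : ℕ => (1 / (p : ℝ)) * ∑ j ∈ Finset.range p, variance (X j) P)
      atTop (𝓝 τ)) (i j : ℕ) :
    Tendsto (fun p : ℕ =>
      ∫ ω, centered P X i ω * (X j ω - w p j) ^ 2 * distSlope M X (w p) p i ω ∂P) atTop
      (𝓝 (1 / √τ * (1 / (2 * τ)) * ∫ ω, centered P X i ω * centered P X j ω ^ 2 ∂P)) := by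
  obtain ⟨A, p₁, hA, hwA⟩ := h.exists_abs_sub_mean_le_div hq
  obtain ⟨D, p₂, hD⟩ := h.exists_term_bound hq hA
  obtain ⟨m, hm, hmq⟩ := exists_slope_exponent hq
  obtain ⟨B, p₃, hB⟩ := h.exists_distSlope_moment_bound hm
  set L := 1 / √τ * (1 / (2 * τ)) with hL
  have hL0 : 0 ≤ L := by positivity
  have hadiv : ∀ᶠ p : ℕ in atTop, |w p j - ∫ ω, X j ω ∂P| ≤ A / p := by
    filter_upwards [eventually_ge_atTop (max p₁ (M + 2)), eventually_gt_atTop j] with p hp hj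
    exact hwA p ((le_max_left _ _).trans hp) _ (hw p ((le_max_right _ _).trans hp)) j hj
  have haA : ∀ᶠ p : ℕ in atTop, |w p j - ∫ ω, X j ω ∂P| ≤ A := by
    filter_upwards [hadiv, eventually_ge_atTop 1] with p hp hp1
    exact hp.trans (div_le_self hA (by exact_mod_cast hp1))
  have ha0 : Tendsto (fun p => w p j - ∫ ω, X j ω ∂P) atTop (𝓝 0) := by
    rw [tendsto_zero_iff_abs_tendsto_zero]
    exact squeeze_zero' (Eventually.of_forall fun p => abs_nonneg _) hadiv
      (tendsto_const_div_atTop_nhds_zero_nat A)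
  have hcube := h.integrable_add_add_cube hq hA i j
  have iY3 : Integrable (fun ω => centered P X i ω * centered P X j ω ^ 2) P := by
    refine hcube.mono' ((h.measurable_centered i).mul
      ((h.measurable_centered j).pow_const 2)).aestronglyMeasurable (ae_of_all _ fun ω => ?_)
    exact abs_centered_mul_sub_sq_le (w := fun j => ∫ ω', X j ω' ∂P) (j := j) (by simpa using hA) i ω
  have iV : ∀ p, |w p j - ∫ ω, X j ω ∂P| ≤ A →
      Integrable (fun ω => centered P X i ω * (X j ω - w p j) ^ 2) P := fun p hp =>
    hcube.mono' ((h.measurable_centered i).mul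
      (((h.measurable j).sub_const _).pow_const 2)).aestronglyMeasurable
      (ae_of_all _ fun ω => abs_centered_mul_sub_sq_le hp i ω)
  -- the limit of the integrals with the slope replaced by its limit `L`
  have hV : Tendsto (fun p : ℕ => ∫ ω, centered P X i ω * (X j ω - w p j) ^ 2 ∂P) atTop
      (𝓝 (∫ ω, centered P X i ω * centered P X j ω ^ 2 ∂P)) := by
    have e : ∀ p, ∫ ω, centered P X i ω * (X j ω - w p j) ^ 2 ∂P =
        ∫ ω, centered P X i ω * centered P X j ω ^ 2 ∂P -
          2 * (w p j - ∫ ω, X j ω ∂P) * ∫ ω, centered P X i ω * centered P X j ω ∂P := by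
      intro p
      set a := w p j - ∫ ω, X j ω ∂P with ha
      have e1 : ∀ ω, centered P X i ω * (X j ω - w p j) ^ 2 =
          centered P X i ω * centered P X j ω ^ 2 -
            2 * a * (centered P X i ω * centered P X j ω) + a ^ 2 * centered P X i ω := fun ω => by
        have : X j ω - w p j = centered P X j ω - a := by
          simp only [centered, ha]
          ring
        rw [this]
        ring
      have i2 := (h.integrable_centered_mul i j).const_mul (2 * a)
      have i3 : Integrable (fun ω => centered P X i ω * centered P X j ω ^ 2 -
          2 * a * (centered P X i ω * centered P X j ω)) P := iY3.sub i2
      simp_rw [e1]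
      rw [integral_add i3 ((h.integrable_centered i).const_mul _), integral_sub iY3 i2,
        integral_const_mul, integral_const_mul, h.integral_centered, mul_zero, add_zero]
    simp_rw [e]
    have := (ha0.const_mul 2).mul_const (∫ ω, centered P X i ω * centered P X j ω ∂P)
    simpa using this.const_sub (∫ ω, centered P X i ω * centered P X j ω ^ 2 ∂P)
  have hsp : ∀ p ω, |distSlope M X (w p) p i ω - L| ^ (2 * m) ≤
      2 ^ (2 * m - 1) * (distSlope M X (w p) p i ω ^ (2 * m) + L ^ (2 * m)) := fun p ω => by
    have h0 := distSlope_nonneg (M := M) (X := X) (w p) p i ω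
    refine le_trans (pow_le_pow_left₀ (abs_nonneg _) ?_ _) (add_pow_le h0 hL0 (2 * m))
    refine (abs_sub _ _).trans_eq ?_
    rw [abs_of_nonneg h0, abs_of_nonneg hL0]
  have hH := tendsto_integral_mul_zero (P := P) (s := q / 3) (k := 2 * m) (by linarith)
    (by omega) hmq (V := fun p ω => centered P X i ω * (X j ω - w p j) ^ 2)
    (H := fun p ω => distSlope M X (w p) p i ω - L)
    (V₀ := fun ω => (|centered P X i ω| + |centered P X j ω| + A) ^ 3)
    (B := 2 ^ (2 * m - 1) * (B + L ^ (2 * m))) hcube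
    (by
      refine (h.integrable_add_add_rpow hA i j).1.congr (ae_of_all _ fun ω => ?_)
      simp only
      rw [← Real.rpow_natCast _ 3, ← Real.rpow_mul (by positivity)]
      congr 1
      push_cast
      ring)
    (by
      filter_upwards [haA] with p hp ω
      exact abs_centered_mul_sub_sq_le hp i ω)
    (fun p => (h.measurable_distSlope (w p) p i).sub_const L)
    (by
      filter_upwards [eventually_ge_atTop p₃] with p hp
      obtain ⟨hi, hle⟩ := hB p hp (w p) i
      have i1 : Integrable (fun ω => distSlope M X (w p) p i ω ^ (2 * m) + L ^ (2 * m)) P :=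
        hi.add (integrable_const _)
      have hi' : Integrable (fun ω => |distSlope M X (w p) p i ω - L| ^ (2 * m)) P :=
        (i1.const_mul _).mono'
          (((h.measurable_distSlope (w p) p i).sub_const L).abs.pow_const _).aestronglyMeasurable
          (ae_of_all _ fun ω => by
            rw [Real.norm_of_nonneg (by positivity)]
            exact hsp p ω)
      refine ⟨hi', (integral_mono hi' (i1.const_mul _) (hsp p)).trans ?_⟩
      rw [integral_const_mul, integral_add hi (integrable_const _), integral_const,
        probReal_univ, one_smul]
      gcongr)
    (fun ε hε => by
      have := tendsto_measureReal_le_abs_comp_sub (P := P) (continuousAt_invSqrtSlope hτ0)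
        (fun p => (h.integrable_sqDist (w p) (Finset.range p \ exclusionSet M i)).div_const (p : ℝ))
        (fun p => (h.integrable_sqDist (w p) (Finset.range p)).div_const (p : ℝ))
        (h.tendsto_integral_abs_sqDist_sdiff_div_sub hq hw hτ i)
        (h.tendsto_integral_abs_sqDist_div_sub hq hw hτ) hε
      simp only [invSqrtSlope_self hτ0] at this
      exact this)
  have hsum := hH.add (hV.const_mul L)
  rw [zero_add] at hsum
  refine hsum.congr' ?_
  filter_upwards [haA, eventually_ge_atTop p₂] with p hp hp₂
  have i1 := (hD p hp₂ (w p) i j hp).1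
  have i2 := iV p hp
  rw [← integral_const_mul, ← integral_add]
  · refine integral_congr_ae (ae_of_all _ fun ω => ?_)
    simp only
    ring
  · have e : (fun ω => centered P X i ω * (X j ω - w p j) ^ 2 * (distSlope M X (w p) p i ω - L)) =
        fun ω => centered P X i ω * (X j ω - w p j) ^ 2 * distSlope M X (w p) p i ω -
          L * (centered P X i ω * (X j ω - w p j) ^ 2) := by
      ext ω
      ring
    rw [e]
    exact i1.sub (i2.const_mul L)
  · exact i2.const_mul L

/-- The rescaled deviation of the median from the mean converges. -/
theorem tendsto_mul_sub_mean (h : ClassD P M q c σmin C X) (hq : 3 < q)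
    (hw : ∀ p ≥ M + 2, IsMedianCenter P X p (w p)) (hτ0 : 0 < τ)
    (hτ : Tendsto (fun p : ℕ => (1 / (p : ℝ)) * ∑ j ∈ Finset.range p, variance (X j) P)
      atTop (𝓝 τ)) (i : ℕ) :
    Tendsto (fun p : ℕ => p * (w p i - ∫ ω, X i ω ∂P)) atTop
      (𝓝 (-(1 / (2 * τ) * ∑ j ∈ exclusionSet M i,
        ∫ ω, centered P X i ω * centered P X j ω ^ 2 ∂P))) := by
  obtain ⟨A, p₁, hA, hwA⟩ := h.exists_abs_sub_mean_le
  obtain ⟨p₂, hE⟩ := h.exists_mul_sub_mul_integral_eq hq hA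
  have hI := h.tendsto_integral_sqrt_div hq hw hτ0 hτ
  have hs : 0 < 1 / √τ := by
    have := Real.sqrt_pos.2 hτ0
    positivity
  have hT := (tendsto_finsetSum (exclusionSet M i)
    fun j _ => h.tendsto_integral_term hq hw hτ0 hτ i j).neg
  have hdiv := hT.div hI hs.ne'
  have e : -(∑ j ∈ exclusionSet M i, 1 / √τ * (1 / (2 * τ)) *
      ∫ ω, centered P X i ω * centered P X j ω ^ 2 ∂P) / (1 / √τ) =
      -(1 / (2 * τ) * ∑ j ∈ exclusionSet M i,
        ∫ ω, centered P X i ω * centered P X j ω ^ 2 ∂P) := by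
    rw [← Finset.mul_sum]
    have := Real.sqrt_pos.2 hτ0
    field_simp
  rw [e] at hdiv
  refine hdiv.congr' ?_
  filter_upwards [hI.eventually (lt_mem_nhds hs),
    eventually_ge_atTop (max (max p₁ p₂) (max (M + 2) (i + M + 1)))] with p hIp hp
  have hinter : Finset.range p ∩ exclusionSet M i = exclusionSet M i := by
    refine Finset.inter_eq_right.2 fun j hj => ?_
    rw [exclusionSet, Finset.mem_Icc] at hj
    rw [Finset.mem_range]
    omega
  have hwp := hw p (by omega)
  have key := hE p (by omega) (w p) hwp (hwA p (by omega) _ hwp) i (by omega)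
  rw [hinter] at key
  rw [Pi.div_apply, div_eq_iff hIp.ne']
  exact key.symm

end ClassD

/-- The limit `ClassD.tendsto_mul_sub_mean` restated with a remainder. The lower bound on the standard
deviations makes `σbar ^ 2` positive, so no division by zero occurs. -/
theorem ClassD.exists_isLittleO (h : ClassD P M q c σmin C X) (hq : 3 < q)
    (m : (p : ℕ) → EuclideanSpace ℝ (Fin p))
    (hm : ∀ p : ℕ, M + 2 ≤ p → IsGeometricMedian P (firstComponents X p) (m p)) (i : ℕ) (σbar : ℝ)
    (hσ : Tendsto (fun p : ℕ => (1 / (p : ℝ)) * ∑ j ∈ Finset.range p, variance (X j) P)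
      atTop (𝓝 (σbar ^ 2))) :
    ∃ r : ℕ → ℝ, r =o[atTop] (fun p : ℕ => 1 / (p : ℝ)) ∧
      ∀ (p : ℕ) (hp : i < p),
        m p ⟨i, hp⟩ = (∫ ω, X i ω ∂P)
          - 1 / (2 * σbar ^ 2 * (p : ℝ)) *
            (∑ j ∈ exclusionSet M i,
              ∫ ω, (X i ω - ∫ ω', X i ω' ∂P) * (X j ω - ∫ ω', X j ω' ∂P) ^ 2 ∂P)
          + r p := by
  set w : ℕ → ℕ → ℝ := fun p j => if hj : j < p then m p ⟨j, hj⟩ else 0 with hw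
  have hwm : ∀ p ≥ M + 2, IsMedianCenter P X p (w p) := fun p hp =>
    (hm p hp).isMedianCenter h fun j => by simp [hw]
  set S := ∑ j ∈ exclusionSet M i,
    ∫ ω, (X i ω - ∫ ω', X i ω' ∂P) * (X j ω - ∫ ω', X j ω' ∂P) ^ 2 ∂P with hS
  have hτ0 : 0 < σbar ^ 2 := by
    have hσ0 := h.σmin_pos
    refine lt_of_lt_of_le (show 0 < σmin ^ 2 by positivity) (ge_of_tendsto hσ ?_)
    filter_upwards [eventually_ge_atTop 1] with p hp
    have hp' : (0 : ℝ) < p := by exact_mod_cast hp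
    calc σmin ^ 2 = (1 / (p : ℝ)) * ∑ j ∈ Finset.range p, σmin ^ 2 := by
          rw [Finset.sum_const, Finset.card_range, nsmul_eq_mul]
          field_simp
      _ ≤ _ := by
          gcongr with j _
          exact h.sq_le_variance j
  have key := h.tendsto_mul_sub_mean hq hwm hτ0 hσ i
  refine ⟨fun p => w p i - ∫ ω, X i ω ∂P + 1 / (2 * σbar ^ 2 * (p : ℝ)) * S, ?_, fun p hp => ?_⟩
  · rw [isLittleO_iff_tendsto' (by
      filter_upwards [eventually_ge_atTop 1] with p hp h0
      have hp' : (0 : ℝ) < p := by exact_mod_cast hp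
      exact absurd h0 (by positivity))]
    have h2 := key.add_const (1 / (2 * σbar ^ 2) * S)
    have e : -(1 / (2 * σbar ^ 2) * ∑ j ∈ exclusionSet M i,
        ∫ ω, centered P X i ω * centered P X j ω ^ 2 ∂P) + 1 / (2 * σbar ^ 2) * S = 0 :=
      neg_add_cancel _
    rw [e] at h2
    refine h2.congr' ?_
    filter_upwards [eventually_ge_atTop 1] with p hp
    have hp' : (0 : ℝ) < p := by exact_mod_cast hp
    field_simp
  · simp only [hw, hp, dif_pos]
    ring

end Expansion

/-! ### An independent sequence with skewed marginals -/

section Sharpness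

lemma ProbabilityTheory.iIndepFun.isMDependent {Ω : Type*} [MeasurableSpace Ω] {P : Measure Ω}
    {X : ℕ → Ω → ℝ} (h : iIndepFun X P) (hX : ∀ j, Measurable (X j)) (M : ℕ) :
    IsMDependent P M X := by
  intro k
  have hcomap : ∀ s : Set ℕ, (MeasurableSpace.pi : MeasurableSpace (s → ℝ)).comap
      (fun ω (j : s) => X j ω) = ⨆ j ∈ s, MeasurableSpace.comap (X j) inferInstance := by
    intro s
    rw [MeasurableSpace.pi, MeasurableSpace.comap_iSup, iSup_subtype']
    refine iSup_congr fun j => ?_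
    rw [MeasurableSpace.comap_comp]
    rfl
  rw [IndepFun_iff_Indep, hcomap, hcomap]
  refine indep_iSup_of_disjoint (fun j => (hX j).comap_le) h ?_
  rw [Set.disjoint_left]
  intro j hj hj'
  simp only [Set.mem_Iic, Set.mem_Ici] at hj hj'
  omega

open scoped ENNReal

/-- The triangular density `2x` on `[0, 1]`. -/
noncomputable def triangularPDF : ℝ → ℝ≥0∞ :=
  (Set.Icc (0 : ℝ) 1).indicator fun x => ENNReal.ofReal (2 * x)

lemma measurable_triangularPDF : Measurable triangularPDF :=
  Measurable.indicator (by fun_prop) measurableSet_Icc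

/-- The law on `[0, 1]` with density `2x`. Its mean is `2 / 3`, its variance `1 / 18` and its third
central moment `-1 / 135`. -/
noncomputable def triangularMeasure : Measure ℝ := volume.withDensity triangularPDF

lemma triangularMeasure_eq : triangularMeasure =
    (volume.restrict (Set.Icc (0 : ℝ) 1)).withDensity fun x => ENNReal.ofReal (2 * x) :=
  withDensity_indicator measurableSet_Icc _

lemma integral_triangularMeasure (g : ℝ → ℝ) :
    ∫ x, g x ∂triangularMeasure = ∫ x in (0 : ℝ)..1, 2 * x * g x := by
  rw [triangularMeasure_eq, integral_withDensity_eq_integral_toReal_smul (by fun_prop)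
    (ae_of_all _ fun x => ENNReal.ofReal_lt_top), intervalIntegral.integral_of_le zero_le_one,
    ← integral_Icc_eq_integral_Ioc]
  refine setIntegral_congr_fun measurableSet_Icc fun x hx => ?_
  simp only [smul_eq_mul]
  rw [ENNReal.toReal_ofReal (by linarith [hx.1])]

instance : IsProbabilityMeasure triangularMeasure := by
  constructor
  rw [triangularMeasure_eq, withDensity_apply _ MeasurableSet.univ, Measure.restrict_univ,
    ← ofReal_integral_eq_lintegral_ofReal]
  · rw [integral_Icc_eq_integral_Ioc, ← intervalIntegral.integral_of_le zero_le_one,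
      intervalIntegral.integral_const_mul, integral_id]
    norm_num
  · exact (continuous_const.mul continuous_id).continuousOn.integrableOn_Icc
  · filter_upwards [ae_restrict_mem measurableSet_Icc] with x hx
    simpa using hx.1

lemma ae_mem_Icc_triangularMeasure : ∀ᵐ x ∂triangularMeasure, x ∈ Set.Icc (0 : ℝ) 1 := by
  rw [triangularMeasure_eq]
  exact (withDensity_absolutelyContinuous _ _).ae_le (ae_restrict_mem measurableSet_Icc)

lemma integral_id_triangularMeasure : ∫ x, x ∂triangularMeasure = 2 / 3 := by
  have e : ∀ x : ℝ, 2 * x * x = 2 * x ^ 2 := fun x => by ring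
  rw [integral_triangularMeasure]
  simp_rw [e]
  rw [intervalIntegral.integral_const_mul, integral_pow]
  norm_num

lemma integral_sq_triangularMeasure : ∫ x, (x - 2 / 3) ^ 2 ∂triangularMeasure = 1 / 18 := by
  have hd : ∀ x : ℝ, HasDerivAt (fun x : ℝ => x ^ 4 / 2 - 8 / 9 * x ^ 3 + 4 / 9 * x ^ 2)
      (2 * x * (x - 2 / 3) ^ 2) x := fun x => by
    have := (((hasDerivAt_pow 4 x).div_const 2).sub ((hasDerivAt_pow 3 x).const_mul (8 / 9))).add
      ((hasDerivAt_pow 2 x).const_mul (4 / 9))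
    refine this.congr_deriv ?_
    norm_num
    ring
  rw [integral_triangularMeasure, intervalIntegral.integral_eq_sub_of_hasDerivAt (fun x _ => hd x)
    (Continuous.intervalIntegrable (by fun_prop) _ _)]
  norm_num

lemma integral_cube_triangularMeasure : ∫ x, (x - 2 / 3) ^ 3 ∂triangularMeasure = -1 / 135 := by
  have hd : ∀ x : ℝ, HasDerivAt
      (fun x : ℝ => 2 / 5 * x ^ 5 - x ^ 4 + 8 / 9 * x ^ 3 - 8 / 27 * x ^ 2)
      (2 * x * (x - 2 / 3) ^ 3) x := fun x => by
    have := ((((hasDerivAt_pow 5 x).const_mul (2 / 5)).sub (hasDerivAt_pow 4 x)).add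
      ((hasDerivAt_pow 3 x).const_mul (8 / 9))).sub ((hasDerivAt_pow 2 x).const_mul (8 / 27))
    refine this.congr_deriv ?_
    norm_num
    ring
  rw [integral_triangularMeasure, intervalIntegral.integral_eq_sub_of_hasDerivAt (fun x _ => hd x)
    (Continuous.intervalIntegrable (by fun_prop) _ _)]
  norm_num

/-- The law of an independent sequence with marginals `triangularMeasure`. -/
noncomputable abbrev triangularProduct : Measure (ℕ → ℝ) :=
  Measure.infinitePi fun _ : ℕ => triangularMeasure

lemma map_eval_triangularProduct (j : ℕ) :
    triangularProduct.map (fun ω => ω j) = triangularMeasure :=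
  Measure.infinitePi_map_eval (fun _ : ℕ => triangularMeasure) j

lemma integral_eval_triangularProduct (j : ℕ) {g : ℝ → ℝ} (hg : Measurable g) :
    ∫ ω, g (ω j) ∂triangularProduct = ∫ x, g x ∂triangularMeasure := by
  rw [← map_eval_triangularProduct j, integral_map (measurable_pi_apply j).aemeasurable
    hg.aestronglyMeasurable]

lemma iIndepFun_triangularProduct :
    iIndepFun (fun (j : ℕ) (ω : ℕ → ℝ) => ω j) triangularProduct :=
  iIndepFun_infinitePi (P := fun _ : ℕ => triangularMeasure) (X := fun _ x => x)
    fun _ => measurable_id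

lemma mean_triangularProduct (j : ℕ) : ∫ ω, ω j ∂triangularProduct = 2 / 3 :=
  (integral_eval_triangularProduct j measurable_id).trans integral_id_triangularMeasure

lemma variance_triangularProduct (j : ℕ) :
    variance (fun ω : ℕ → ℝ => ω j) triangularProduct = 1 / 18 := by
  rw [variance_eq_integral (measurable_pi_apply j).aemeasurable, mean_triangularProduct,
    integral_eval_triangularProduct j (g := fun x => (x - 2 / 3) ^ 2) (by fun_prop),
    integral_sq_triangularMeasure]

lemma classD_triangularProduct (M : ℕ) {q : ℝ} (hq : 2 ≤ q) :
    ClassD triangularProduct M q 2 √(1 / 18) 1 (fun j ω => ω j) := by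
  have hae : ∀ j : ℕ, ∀ᵐ ω ∂triangularProduct, ω j ∈ Set.Icc (0 : ℝ) 1 := fun j =>
    ae_of_ae_map (measurable_pi_apply j).aemeasurable
      (by rw [map_eval_triangularProduct]; exact ae_mem_Icc_triangularMeasure)
  have hpdf : ∀ j : ℕ, HasPDF (fun ω : ℕ → ℝ => ω j) triangularProduct volume := fun j =>
    hasPDF_of_map_eq_withDensity (measurable_pi_apply j).aemeasurable triangularPDF
      measurable_triangularPDF.aemeasurable (map_eval_triangularProduct j)
  have hpow : ∀ (j : ℕ) (a : ℝ), a ∈ Set.Icc (0 : ℝ) 1 →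
      ∀ᵐ ω ∂triangularProduct, ‖|ω j - a| ^ q‖ ≤ 1 := fun j a ha => by
    filter_upwards [hae j] with ω hω
    rw [Real.norm_of_nonneg (by positivity)]
    refine Real.rpow_le_one (abs_nonneg _) ?_ (by linarith)
    rw [abs_le]
    constructor <;> linarith [hω.1, hω.2, ha.1, ha.2]
  have hint : ∀ (j : ℕ) (a : ℝ), a ∈ Set.Icc (0 : ℝ) 1 →
      Integrable (fun ω : ℕ → ℝ => |ω j - a| ^ q) triangularProduct := fun j a ha =>
    (integrable_const (1 : ℝ)).mono' (by
      have : Measurable fun ω : ℕ → ℝ => |ω j - a| ^ q := by fun_prop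
      exact this.aestronglyMeasurable) (hpow j a ha)
  have hle : ∀ (j : ℕ) (a : ℝ), a ∈ Set.Icc (0 : ℝ) 1 →
      ∫ ω, |ω j - a| ^ q ∂triangularProduct ≤ 1 := fun j a ha => by
    refine (le_abs_self _).trans ((norm_integral_le_of_norm_le (integrable_const (1 : ℝ))
      (hpow j a ha)).trans ?_)
    simp
  exact
    { c_pos := two_pos
      σmin_pos := by positivity
      two_le_q := hq
      one_le_C := le_rfl
      measurable := fun j => measurable_pi_apply j
      hasPDF := hpdf
      pdf_le := fun j => by
        have := hpdf j
        have e := (pdf.eq_of_map_eq_withDensity (X := fun ω : ℕ → ℝ => ω j) triangularPDF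
          measurable_triangularPDF.aemeasurable).1 (map_eval_triangularProduct j)
        filter_upwards [e] with x hx
        rw [hx, triangularPDF]
        refine Set.indicator_apply_le' (fun hx => ENNReal.ofReal_le_ofReal ?_) fun _ => zero_le
        linarith [hx.2]
      mDependent := iIndepFun_triangularProduct.isMDependent (fun j => measurable_pi_apply j) M
      integrable_abs_pow := fun j => by simpa using hint j 0 (by norm_num)
      abs_pow_le := fun j => by simpa using hle j 0 (by norm_num)
      integrable_abs_sub_pow := fun j => by
        rw [mean_triangularProduct]
        exact hint j _ (by norm_num)
      abs_sub_pow_le := fun j => by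
        rw [mean_triangularProduct]
        exact hle j _ (by norm_num)
      le_sd := fun j => by rw [variance_triangularProduct] }

/-- By independence only the third central moment survives among the mixed moments. -/
lemma sum_exclusionSet_triangularProduct (M i : ℕ) :
    ∑ j ∈ exclusionSet M i, ∫ ω : ℕ → ℝ, (ω i - ∫ ω', ω' i ∂triangularProduct) *
      (ω j - ∫ ω', ω' j ∂triangularProduct) ^ 2 ∂triangularProduct = -1 / 135 := by
  simp_rw [mean_triangularProduct]
  rw [Finset.sum_eq_single i]
  · have e : ∀ ω : ℕ → ℝ, (ω i - 2 / 3) * (ω i - 2 / 3) ^ 2 = (ω i - 2 / 3) ^ 3 := fun ω => by ring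
    simp_rw [e]
    rw [integral_eval_triangularProduct i (g := fun x => (x - 2 / 3) ^ 3) (by fun_prop),
      integral_cube_triangularMeasure]
  · intro j _ hji
    have hind := (iIndepFun_triangularProduct.indepFun hji.symm).comp
      (φ := fun x : ℝ => x - 2 / 3) (ψ := fun x : ℝ => (x - 2 / 3) ^ 2) (by fun_prop) (by fun_prop)
    have e := hind.integral_fun_mul_eq_mul_integral
      (Measurable.aestronglyMeasurable (by fun_prop))
      (Measurable.aestronglyMeasurable (by fun_prop))
    simp only [Function.comp] at e
    rw [e]
    have h0 : ∫ ω : ℕ → ℝ, (ω i - 2 / 3) ∂triangularProduct = 0 := by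
      have := (classD_triangularProduct 0 le_rfl).integral_centered i
      simpa [centered, mean_triangularProduct] using this
    rw [h0, zero_mul]
  · intro hi
    exact absurd (by rw [exclusionSet, Finset.mem_Icc]; omega) hi

end Sharpness

/-! ### Expansion of the median and sharpness of the rate -/

theorem mainTheorem2 (M : ℕ) (q : ℝ) (hq : 3 < q) :
    (∀ {Ω : Type*} [MeasurableSpace Ω] (P : Measure Ω) [IsProbabilityMeasure P]
        (c σmin C : ℝ) (X : ℕ → Ω → ℝ), ClassD P M q c σmin C X →
      (∀ p : ℕ, M + 2 ≤ p → ∃! v, IsGeometricMedian P (firstComponents X p) v) ∧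
      ∀ m : (p : ℕ) → EuclideanSpace ℝ (Fin p),
        (∀ p : ℕ, M + 2 ≤ p → IsGeometricMedian P (firstComponents X p) (m p)) →
        ∀ (i : ℕ) (σbar : ℝ),
          Tendsto (fun p : ℕ => (1 / (p : ℝ)) * ∑ j ∈ Finset.range p, variance (X j) P)
            atTop (𝓝 (σbar ^ 2)) →
          ∃ r : ℕ → ℝ, r =o[atTop] (fun p : ℕ => 1 / (p : ℝ)) ∧
            ∀ (p : ℕ) (hp : i < p),
              m p ⟨i, hp⟩ = (∫ ω, X i ω ∂P)
                - 1 / (2 * σbar ^ 2 * (p : ℝ)) *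
                  (∑ j ∈ exclusionSet M i,
                    ∫ ω, (X i ω - ∫ ω', X i ω' ∂P) * (X j ω - ∫ ω', X j ω' ∂P) ^ 2 ∂P)
                + r p) ∧
    (∃ (c σmin C : ℝ) (Ω : Type) (_ : MeasurableSpace Ω) (P : Measure Ω) (X : ℕ → Ω → ℝ),
      IsProbabilityMeasure P ∧ ClassD P M q c σmin C X ∧
      ∃ b : ℝ, 0 < b ∧
        ∀ m : (p : ℕ) → EuclideanSpace ℝ (Fin p),
          (∀ p : ℕ, M + 2 ≤ p → IsGeometricMedian P (firstComponents X p) (m p)) →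
          ∀ i : ℕ, ∀ᶠ p : ℕ in atTop, ∀ hp : i < p,
            b / (p : ℝ) ≤ |m p ⟨i, hp⟩ - ∫ ω, X i ω ∂P|) := by
  refine ⟨fun P _ c σmin C X h => ⟨fun p hp => h.existsUnique_isGeometricMedian p hp,
    fun m hm i σbar hσ => h.exists_isLittleO hq m hm i σbar hσ⟩, ?_⟩
  have hD := classD_triangularProduct M (q := q) (by linarith)
  refine ⟨2, √(1 / 18), 1, ℕ → ℝ, inferInstance, triangularProduct, fun j ω => ω j, inferInstance,
    hD, 1 / 30, by norm_num, fun m hm i => ?_⟩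
  have hσ : (√(1 / 18) : ℝ) ^ 2 = 1 / 18 := Real.sq_sqrt (by norm_num)
  obtain ⟨r, hr, hmr⟩ := hD.exists_isLittleO hq m hm i √(1 / 18) (by
    rw [hσ]
    refine tendsto_const_nhds.congr' ?_
    filter_upwards [eventually_ge_atTop 1] with p hp
    have hp' : (0 : ℝ) < p := by exact_mod_cast hp
    simp_rw [variance_triangularProduct]
    rw [Finset.sum_const, Finset.card_range, nsmul_eq_mul]
    field_simp)
  -- the leading term is `1 / (15 p)`, twice the claimed lower bound
  filter_upwards [hr.def (show (0 : ℝ) < 1 / 30 by norm_num), eventually_ge_atTop 1]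
    with p hrp hp1 hp
  have hp' : (0 : ℝ) < p := by exact_mod_cast hp1
  rw [hmr p hp, sum_exclusionSet_triangularProduct, hσ]
  rw [Real.norm_eq_abs, Real.norm_of_nonneg (by positivity)] at hrp
  have e : 1 / (2 * (1 / 18) * (p : ℝ)) * (-1 / 135) = -(1 / 15 * (1 / (p : ℝ))) := by
    field_simp
    norm_num
  have e2 : 1 / 30 / (p : ℝ) = 1 / 30 * (1 / (p : ℝ)) := by ring
  rw [e, e2]
  refine le_trans ?_ (le_abs_self _)
  have := neg_le_of_abs_le hrp
  linarith
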